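/- **Theorem (Classification).** A *finite linear partial monitoring game* consists of a finite nonempty action set $\mathcal A$, reward features $\phi_a\in\mathbb R^d$ and linear observation maps $M_a\in\mathbb R^{m\times d}$ ($a\in\mathcal A$), and a nonempty, bounded, convex parameter set $\Theta\subset\mathbb R^d$. *Interaction.* Fix $\rho>0$. In each round $t=1,2,\dots$ the learner draws an action $a_t$ from a distribution $\pi_t(\cdot\mid a_1,y_1,\dots,a_{t-1},y_{t-1})$ and observes $y_t=M_{a_t}\theta+\epsilon_t\in\mathbb R^m$, where $\theta\in\Theta$ is unknown and, conditionally on the history and on $a_t$, the noise $\epsilon_t$ has mean zero and is $\rho$-sub-Gaussian, $\mathbb E[\exp(u^\top\epsilon_t)\mid a_1,y_1,\dots,a_{t-1},y_{t-1},a_t]\le\exp(\|u\|^2\rho^2/2)$ for all $u\in\mathbb R^m$; its conditional law may depend on the history and on $a_t$. Let $\mathcal N$ be any class of such noise models that contains the i.i.d. Gaussian noise $\mathcal N(0,\rho^2 I_m)$. The expected regret of a policy $\pi=(\pi_t)_t$ is $\mathfrak R_n(\pi,\theta,\xi)=\max_{a\in\mathcal A}\mathbb E\big[\sum_{t=1}^n\langle\phi_a-\phi_{a_t},\theta\rangle\big]$,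 and the minimax regret is $\mathfrak R_n^*=\inf_\pi\sup_{\theta\in\Theta}\sup_{\xi\in\mathcal N}\mathfrak R_n(\pi,\theta,\xi)$. *Geometry.* Let $\mathcal C_a=\{\theta\in\Theta:\langle\phi_a,\theta\rangle=\max_b\langle\phi_b,\theta\rangle\}$, and let $\mathcal P$ be the set of Pareto optimal actions: those with $\mathcal C_a\neq\emptyset$ and $\dim\mathcal C_a=\dim\Theta$ (dimensions of affine hulls). Let $\mathcal V=\operatorname{span}\{\theta-\nu:\theta,\nu\in\Theta\}$ and let $\operatorname{Proj}_{\mathcal V}$ be the orthogonal projection onto $\mathcal V$. The game is *globally observable* if $\operatorname{Proj}_{\mathcal V}(\phi_a-\phi_b)\in\operatorname{span}\{\operatorname{Proj}_{\mathcal V}M_c^\top w:c\in\mathcal A,\,w\in\mathbb R^m\}$ for all $a,b\in\mathcal P$. Put $\Delta(a|\theta)=\max_b\langle\phi_b-\phi_a,\theta\rangle$. For $\mathcal E\subset\Theta$ and $\eta>0$ let $\mathcal P(\mathcal E)=\{a\in\mathcal P:\Delta(a|\theta)=0\text{ for some }\theta\in\mathcal E\}$, $$\bar{\mathcal P}_\eta(\mathcal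 E)=\Big\{a\in\mathcal A:\sup_{\theta\in\mathcal E}\Delta(a|\theta)\le\eta\sup_{b\in\mathcal P(\mathcal E)}\sup_{\theta\in\mathcal E}\Delta(b|\theta)\Big\},$$ $$\alpha_\eta(\mathcal E)=\sup_{\nu\in\mathcal V}\ \sup_{a,b\in\mathcal P(\mathcal E)}\ \inf_{c\in\bar{\mathcal P}_\eta(\mathcal E)}\frac{\langle\phi_a-\phi_b,\nu\rangle^2}{\|M_c\nu\|^2},\qquad \alpha(\mathcal E)=\inf_{\eta>0}\eta^2\alpha_\eta(\mathcal E),$$ with values in $[0,\infty]$ and the conventions $0/0=0$, $x/0=\infty$ for $x>0$, $\inf\emptyset=\infty$, $\sup\emptyset=0$. The game is *locally observable* if $\sup_{\mathcal E\subset\Theta}\alpha(\mathcal E)<\infty$. It is *trivial* if $\mathcal C_a=\Theta$ for some $a$; *easy* if it is locally observable and not trivial; *hard* if it is globally but not locally observable; *hopeless* if it is not globally observable. *Claim.* As $n\to\infty$, with the game, $\rho$ and $\mathcal N$ fixed, $$\mathfrak R_n^*=\begin{cases}0\ \text{(for every } n)&\text{for trivial games,}\\ \tilde\Theta(n^{1/2})&\text{for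 easy games,}\\ \tilde\Theta(n^{2/3})&\text{for hard games,}\\ \Omega(n)&\text{for hopeless games.}\end{cases}$$ Here $f=\tilde\Theta(g)$ means that there are $k\in\mathbb N$ and $c,C>0$ with $c\,g(n)/(\log n)^k\le f(n)\le C\,g(n)(\log n)^k$ for all large $n$, and $f=\Omega(g)$ means that there is $c>0$ with $f(n)\ge c\,g(n)$ for all large $n$. -/

import Mathlib

open MeasureTheory ProbabilityTheory Filter
open scoped ENNReal NNReal InnerProductSpace

noncomputable section

namespace LinearPM

/-- The Euclidean space `ℝ^d`. -/
abbrev Vec (d : ℕ) : Type := EuclideanSpace ℝ (Fin d)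

/-- A linear partial monitoring game with action set `A`, parameter dimension `d` and observation
dimension `m`: reward features `φ a ∈ ℝ^d`, observation maps `M a : ℝ^d → ℝ^m`, and a nonempty,
convex, bounded set `Θ ⊆ ℝ^d` of parameters. -/
structure Game (A : Type*) (d m : ℕ) where
  φ : A → Vec d
  M : A → Vec d →L[ℝ] Vec m
  Θ : Set (Vec d)
  nonempty_Θ : Θ.Nonempty
  convex_Θ : Convex ℝ Θ
  isBounded_Θ : Bornology.IsBounded Θ

/-- The dimension of the affine hull of `s`, with value `-1` for the empty set. -/
def affDim {d : ℕ} (s : Set (Vec d)) : ℤ :=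
  open Classical in if s = ∅ then -1 else (Module.finrank ℝ (vectorSpan ℝ s) : ℤ)

/-! ### Geometry of a game -/

namespace Game

variable {A : Type*} {d m : ℕ} (G : Game A d m)

/-- The cell of `a`: the parameters for which `a` is optimal. -/
def cell (a : A) : Set (Vec d) :=
  {θ | θ ∈ G.Θ ∧ ∀ b, ⟪G.φ b, θ⟫_ℝ ≤ ⟪G.φ a, θ⟫_ℝ}

/-- The set of Pareto optimal actions. -/
def pareto : Set A := {a | affDim (G.cell a) = affDim G.Θ}

/-- The linear span of the differences `θ - ν` with `θ, ν ∈ Θ`. -/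
def V : Submodule ℝ (Vec d) :=
  Submodule.span ℝ {v | ∃ θ ∈ G.Θ, ∃ ν ∈ G.Θ, v = θ - ν}

/-- The game is trivial: some action is optimal for every parameter. -/
def IsTrivial : Prop := ∃ a, G.cell a = G.Θ

/-- Global observability: for all Pareto optimal `a, b`, the projection of `φ a - φ b` to `V` lies
in the span of the projections of the ranges of the transposes of all the `M c`. -/
def IsGloballyObservable : Prop :=
  ∀ a ∈ G.pareto, ∀ b ∈ G.pareto,
    G.V.starProjection (G.φ a - G.φ b) ∈
      Submodule.span ℝ {v | ∃ (c : A) (w : Vec m),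
        v = G.V.starProjection (ContinuousLinearMap.adjoint (G.M c) w)}

/-- The gap `Δ(a|θ) = max_b ⟨φ b - φ a, θ⟩` (a maximum over a finite action set). -/
def gap (a : A) (θ : Vec d) : ℝ := ⨆ b, ⟪G.φ b - G.φ a, θ⟫_ℝ

/-- The largest gap of `a` over the parameters in `E`. The gap is never negative. -/
def maxGap (E : Set (Vec d)) (a : A) : ℝ≥0∞ := ⨆ θ ∈ E, ENNReal.ofReal (G.gap a θ)

/-- The Pareto optimal actions that are optimal for some parameter in `E`. -/
def plausible (E : Set (Vec d)) : Set A := {a | a ∈ G.pareto ∧ ∃ θ ∈ E, G.gap a θ = 0}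

/-- The extended plausible Pareto set of `E` at level `η`. -/
def extPlausible (η : ℝ≥0) (E : Set (Vec d)) : Set A :=
  {a | G.maxGap E a ≤ η * ⨆ b ∈ G.plausible E, G.maxGap E b}

/-- The local alignment constant `α_η(E)`. In `ℝ≥0∞`, `x / 0 = ∞` for `x ≠ 0`, and `0 / 0 = 0`. -/
def alignAt (η : ℝ≥0) (E : Set (Vec d)) : ℝ≥0∞ :=
  ⨆ ν ∈ G.V, ⨆ a ∈ G.plausible E, ⨆ b ∈ G.plausible E, ⨅ c ∈ G.extPlausible η E,
    ENNReal.ofReal (⟪G.φ a - G.φ b, ν⟫_ℝ ^ 2) / ENNReal.ofReal (‖G.M c ν‖ ^ 2)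

/-- `α(E)`, the infimum of `η² α_η(E)` over `η > 0`. -/
def align (E : Set (Vec d)) : ℝ≥0∞ := ⨅ (η : ℝ≥0) (_ : 0 < η), (η : ℝ≥0∞) ^ 2 * G.alignAt η E

/-- Local observability: `α(E)` is bounded uniformly over all `E ⊆ Θ`. -/
def IsLocallyObservable : Prop := (⨆ (E : Set (Vec d)) (_ : E ⊆ G.Θ), G.align E) < ∞

/-- Easy games are locally observable and not trivial. -/
def IsEasy : Prop := G.IsLocallyObservable ∧ ¬ G.IsTrivial

/-- Hard games are globally but not locally observable. -/
def IsHard : Prop := G.IsGloballyObservable ∧ ¬ G.IsLocallyObservable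

/-- Hopeless games are not globally observable. -/
def IsHopeless : Prop := ¬ G.IsGloballyObservable

end Game

/-! ### Interaction of a policy with an environment -/

section Interaction

variable {A : Type*} [MeasurableSpace A] {d m : ℕ}

/-- Histories of `t` rounds: the pairs (action, observation) of each round. -/
abbrev Hist (A : Type*) (m t : ℕ) : Type _ := Fin t → A × Vec m

/-- A (randomized) policy: after `t` rounds, the next action is drawn from a distribution that
depends measurably on the history of these rounds. -/
structure Policy (A : Type*) [MeasurableSpace A] (m : ℕ) where
  act : (t : ℕ) → Kernel (Hist A m t) A
  markov : ∀ t, IsMarkovKernel (act t)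

/-- A noise model: after `t` rounds, the distribution of the next noise vector may depend on the
history of these rounds and on the action just chosen. -/
structure Noise (A : Type*) [MeasurableSpace A] (m : ℕ) where
  law : (t : ℕ) → Kernel (Hist A m t × A) (Vec m)
  markov : ∀ t, IsMarkovKernel (law t)

attribute [instance] Policy.markov Noise.markov

/-- All conditional noise distributions have mean zero and are `ρ`-sub-Gaussian. -/
def Noise.IsSubGaussian (ξ : Noise A m) (ρ : ℝ) : Prop :=
  ∀ (t : ℕ) (x : Hist A m t × A),
    Integrable (fun e => e) (ξ.law t x) ∧ ∫ e, e ∂(ξ.law t x) = 0 ∧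
    ∀ u : Vec m, Integrable (fun e => Real.exp ⟪u, e⟫_ℝ) (ξ.law t x) ∧
      ∫ e, Real.exp ⟪u, e⟫_ℝ ∂(ξ.law t x) ≤ Real.exp (‖u‖ ^ 2 * ρ ^ 2 / 2)

/-- The Gaussian distribution `N(0, ρ² I)` on `ℝ^m`. -/
def isoGaussian (m : ℕ) (ρ : ℝ) : Measure (Vec m) := (stdGaussian (Vec m)).map (fun e => ρ • e)

instance isProbabilityMeasure_isoGaussian (m : ℕ) (ρ : ℝ) :
    IsProbabilityMeasure (isoGaussian m ρ) :=
  Measure.isProbabilityMeasure_map (by fun_prop)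

/-- Independent `N(0, ρ² I)` noise in each round. -/
def gaussianNoise (A : Type*) [MeasurableSpace A] (m : ℕ) (ρ : ℝ) : Noise A m where
  law _ := Kernel.const _ (isoGaussian m ρ)
  markov _ := inferInstance

/-- One round with parameter `θ`, given the history of `t` rounds: the policy draws an action `a`,
the noise `ε` is drawn, and `y = M a θ + ε` is observed. -/
def stepKernel (G : Game A d m) (π : Policy A m) (θ : Vec d) (ξ : Noise A m) (t : ℕ) :
    Kernel (Hist A m t) (A × Vec m) :=
  (π.act t ⊗ₖ ξ.law t).map (fun p => (p.1, G.M p.1 θ + p.2))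

/-- The law of the history of the first `t` rounds. -/
def histLaw (G : Game A d m) (π : Policy A m) (θ : Vec d) (ξ : Noise A m) :
    (t : ℕ) → Measure (Hist A m t)
  | 0 => Measure.dirac Fin.elim0
  | t + 1 => (histLaw G π θ ξ t ⊗ₘ stepKernel G π θ ξ t).map
      (fun p => Fin.snoc (α := fun _ => A × Vec m) p.1 p.2)

theorem measurable_obs [Countable A] [MeasurableSingletonClass A] (G : Game A d m) (θ : Vec d) :
    Measurable (fun p : A × Vec m => (p.1, G.M p.1 θ + p.2)) := by
  refine measurable_fst.prodMk ?_
  exact ((measurable_of_countable fun a => G.M a θ).comp measurable_fst).add measurable_snd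

theorem measurable_snoc (t : ℕ) :
    Measurable (fun p : Hist A m t × (A × Vec m) =>
      (Fin.snoc (α := fun _ => A × Vec m) p.1 p.2 : Hist A m (t + 1))) := by
  refine measurable_pi_lambda _ fun i => ?_
  refine Fin.lastCases ?_ (fun j => ?_) i
  · simpa using measurable_snd
  · simp only [Fin.snoc_castSucc]
    exact (measurable_pi_apply j).comp measurable_fst

instance isMarkovKernel_stepKernel [Countable A] [MeasurableSingletonClass A] (G : Game A d m)
    (π : Policy A m) (θ : Vec d) (ξ : Noise A m) (t : ℕ) :
    IsMarkovKernel (stepKernel G π θ ξ t) :=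
  Kernel.IsMarkovKernel.map _ (measurable_obs G θ)

instance isProbabilityMeasure_histLaw [Countable A] [MeasurableSingletonClass A] (G : Game A d m)
    (π : Policy A m) (θ : Vec d) (ξ : Noise A m) (t : ℕ) :
    IsProbabilityMeasure (histLaw G π θ ξ t) := by
  induction t with
  | zero => exact Measure.dirac.isProbabilityMeasure
  | succ t ih => exact Measure.isProbabilityMeasure_map (measurable_snoc t).aemeasurable

/-- The expected regret after `n` rounds, `max_a E[∑_t ⟨φ a - φ a_t, θ⟩]`. -/
def regret (G : Game A d m) (π : Policy A m) (θ : Vec d) (ξ : Noise A m) (n : ℕ) : ℝ :=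
  ⨆ a : A, ∫ h, ∑ t : Fin n, ⟪G.φ a - G.φ (h t).1, θ⟫_ℝ ∂(histLaw G π θ ξ n)

/-- The minimax regret over `n` rounds, when the noise model ranges over the class `𝒩`. -/
def minimaxRegret (G : Game A d m) (𝒩 : Set (Noise A m)) (n : ℕ) : EReal :=
  ⨅ π : Policy A m, ⨆ θ ∈ G.Θ, ⨆ ξ ∈ 𝒩, ((regret G π θ ξ n : ℝ) : EReal)

end Interaction

/-! ### Rates -/

/-- `f = Θ̃(g)`: equality of orders up to powers of `log n`. -/
def IsThetaTilde (f : ℕ → EReal) (g : ℕ → ℝ) : Prop :=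
  ∃ (k : ℕ) (c C : ℝ), 0 < c ∧ 0 < C ∧ ∀ᶠ n : ℕ in atTop,
    ((c * g n / Real.log n ^ k : ℝ) : EReal) ≤ f n ∧
      f n ≤ ((C * g n * Real.log n ^ k : ℝ) : EReal)

/-- `f = Ω(g)`. -/
def IsOmega (f : ℕ → EReal) (g : ℕ → ℝ) : Prop :=
  ∃ c : ℝ, 0 < c ∧ ∀ᶠ n : ℕ in atTop, ((c * g n : ℝ) : EReal) ≤ f n

end LinearPM

end

noncomputable section

namespace LinearPM

/-! Lower bounds. All of them come from a kink of the maximal reward (`Game.IsKink`): a relative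
interior point θ of Θ at which two optimal actions have different slopes along some ν in V. At θ +
sν and θ - sν the two gaps of any action add up to at least κs, so a policy that cannot tell these
parameters apart has regret of order ns at one of them (`le_regret_add_regret`). The cases differ in
the price of telling them apart. A non-trivial game has a kink, and s of order n^(-1/2) keeps the
information bounded. In a hopeless game ν can be taken in the kernel of every M_c, so s stays
constant. If local observability fails, ν can be taken in the kernel of M_c for every c optimal at θ
(`exists_isKink_of_not_isLocallyObservable`). Each informative round then costs a constant regret,
and s of order n^(-1/3) balances n^(2/3) regret spent on information against ns.

Upper bounds. A policy works in phases and keeps the set E of parameters compatible with its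
estimates, on which every plausible action has gap at most ε_k. A phase plays actions from a set S
with ⟨φ_a - φ_b, ν⟩² ≤ x ∑_{c ∈ S} ‖M_c ν‖² for all plausible a, b; reaching accuracy ε_{k+1} takes
about x log n / ε_{k+1}² rounds (`exists_phase`, `minimaxRegret_le`). Under global observability S
may be all of A, and one phase to accuracy n^(-1/3) followed by commitment costs n^(2/3) log n.
Under local observability S can have gaps at most ηε_k with η²x bounded
(`Game.IsLocallyObservable.exists_design`). With ε_k halving, a phase of s ≤ n rounds costs at most
sηε_k, whose square is at most n · s(ηε_k)², of order n log n; there are O(log n) phases. Estimation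
errors are controlled by exponential supermartingales, which allow noise that depends on the
history. -/

/-! ### Algebraic relative interior of a convex set -/

/-- The algebraic relative interior of `C`. -/
def core {d : ℕ} (C : Set (Vec d)) : Set (Vec d) :=
  {x | x ∈ C ∧ ∀ v ∈ vectorSpan ℝ C, ∃ s₀ : ℝ, 0 < s₀ ∧ ∀ s, 0 ≤ s → s ≤ s₀ → x + s • v ∈ C}

theorem core_nonempty {d : ℕ} {C : Set (Vec d)} (hC : Convex ℝ C) (hne : C.Nonempty) :
    (core C).Nonempty := by
  obtain ⟨x, hx⟩ := hne.intrinsicInterior hC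
  refine ⟨x, intrinsicInterior_subset hx, fun v hv => ?_⟩
  obtain ⟨y, hy, rfl⟩ := mem_intrinsicInterior.1 hx
  have : Nonempty (affineSpan ℝ C) := ⟨y⟩
  rw [← direction_affineSpan] at hv
  have hcont : Continuous fun s : ℝ => (s • (⟨v, hv⟩ : (affineSpan ℝ C).direction) +ᵥ y) := by
    rw [Topology.IsInducing.subtypeVal.continuous_iff]
    change Continuous fun s : ℝ => s • v + (y : Vec d)
    fun_prop
  have hev := hcont.continuousAt (x := 0) |>.preimage_mem_nhds
    (isOpen_interior.mem_nhds (by simpa using hy))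
  obtain ⟨ε, hε, hball⟩ := Metric.mem_nhds_iff.1 hev
  refine ⟨ε / 2, by positivity, fun s hs0 hs => ?_⟩
  have := interior_subset (hball (show s ∈ Metric.ball (0 : ℝ) ε by
    rw [Metric.mem_ball, dist_zero_right, Real.norm_of_nonneg hs0]; linarith))
  simpa [add_comm] using this

/-- The homothety of ratio `p` centred at `y` maps `C` into itself and shrinks displacements of `x`
by the factor `p`. -/
theorem core_combo {d : ℕ} {C : Set (Vec d)} (hC : Convex ℝ C) {x y : Vec d} (hx : x ∈ core C)
    (hy : y ∈ C) {p q : ℝ} (hp : 0 < p) (hq : 0 ≤ q) (hpq : p + q = 1) :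
    p • x + q • y ∈ core C := by
  refine ⟨hC hx.1 hy hp.le hq hpq, fun v hv => ?_⟩
  obtain ⟨s₀, hs₀, h⟩ := hx.2 v hv
  refine ⟨p * s₀, by positivity, fun s hs hs' => ?_⟩
  have h1 := h (s / p) (by positivity) (by rw [div_le_iff₀ hp]; linarith)
  have h2 := hC h1 hy hp.le hq hpq
  have : p • (x + (s / p) • v) + q • y = p • x + q • y + s • v := by
    rw [smul_add, smul_smul, mul_div_cancel₀ _ hp.ne']; abel
  rwa [this] at h2

theorem convex_core {d : ℕ} {C : Set (Vec d)} (hC : Convex ℝ C) : Convex ℝ (core C) := by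
  intro x hx y hy p q hp hq hpq
  rcases hp.eq_or_lt with rfl | hp
  · have : q = 1 := by linarith
    simpa [this] using hy
  · exact core_combo hC hx hy.1 hp hq hpq

/-! ### Cells, Pareto optimal actions, and kinks of the maximal reward. -/

namespace Game

variable {A : Type*} {d m : ℕ} (G : Game A d m)

theorem V_eq : G.V = vectorSpan ℝ G.Θ := by
  rw [V, vectorSpan]
  congr 1
  ext v
  simp only [Set.mem_ofPred_eq, Set.mem_vsub, vsub_eq_sub]
  constructor
  · rintro ⟨θ, hθ, ν, hν, rfl⟩; exact ⟨θ, hθ, ν, hν, rfl⟩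
  · rintro ⟨θ, hθ, ν, hν, rfl⟩; exact ⟨θ, hθ, ν, hν, rfl⟩

theorem sub_mem_V {θ ν : Vec d} (hθ : θ ∈ G.Θ) (hν : ν ∈ G.Θ) : θ - ν ∈ G.V :=
  Submodule.subset_span ⟨θ, hθ, ν, hν, rfl⟩

/-- The actions that are optimal for `θ`. -/
def optimal (θ : Vec d) : Set A := {a | ∀ b, ⟪G.φ b, θ⟫_ℝ ≤ ⟪G.φ a, θ⟫_ℝ}

theorem convex_cell (a : A) : Convex ℝ (G.cell a) := by
  intro x hx y hy p q hp hq hpq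
  refine ⟨G.convex_Θ hx.1 hy.1 hp hq hpq, fun b => ?_⟩
  simp only [inner_add_right, inner_smul_right]
  have := mul_le_mul_of_nonneg_left (hx.2 b) hp
  have := mul_le_mul_of_nonneg_left (hy.2 b) hq
  linarith

theorem vectorSpan_cell_le (a : A) : vectorSpan ℝ (G.cell a) ≤ G.V := by
  rw [V_eq]; exact vectorSpan_mono ℝ fun _ h => h.1

/-- The span of a cell lies in `V`, so equality of dimensions is equality of subspaces; the value -1
excludes empty cells. -/
theorem mem_pareto_iff {a : A} :
    a ∈ G.pareto ↔ (G.cell a).Nonempty ∧ vectorSpan ℝ (G.cell a) = G.V := by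
  have hΘ : G.Θ ≠ ∅ := G.nonempty_Θ.ne_empty
  simp only [pareto, Set.mem_ofPred_eq, affDim, if_neg hΘ]
  constructor
  · intro h
    by_cases h0 : G.cell a = ∅
    · rw [if_pos h0] at h
      omega
    · rw [if_neg h0] at h
      refine ⟨Set.nonempty_iff_ne_empty.2 h0, ?_⟩
      refine Submodule.eq_of_le_of_finrank_eq (G.vectorSpan_cell_le a) ?_
      rw [V_eq]; exact_mod_cast h
  · rintro ⟨h0, h⟩
    rw [if_neg h0.ne_empty, h, V_eq]

/-- A relative interior point of the cell of `a` can be moved inside the cell along every direction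
of `V`. An action tied with `a` there cannot gain on `a` along `v` or along `-v`, so it is a
duplicate of `a` on Θ. -/
theorem exists_core_of_pareto {a : A} (ha : a ∈ G.pareto) :
    ∃ x ∈ core G.Θ, a ∈ G.optimal x ∧
      ∀ c ∈ G.optimal x, ∀ θ ∈ G.Θ, ⟪G.φ c, θ⟫_ℝ = ⟪G.φ a, θ⟫_ℝ := by
  obtain ⟨hne, hV⟩ := G.mem_pareto_iff.1 ha
  obtain ⟨x, hx, hdir⟩ := core_nonempty (G.convex_cell a) hne
  rw [hV] at hdir
  refine ⟨x, ⟨hx.1, fun v hv => ?_⟩, hx.2, fun c hc θ hθ => ?_⟩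
  · rw [← V_eq] at hv
    obtain ⟨s₀, hs₀, h⟩ := hdir v hv
    exact ⟨s₀, hs₀, fun s h1 h2 => (h s h1 h2).1⟩
  · have hxc : ⟪G.φ c, x⟫_ℝ = ⟪G.φ a, x⟫_ℝ := le_antisymm (hx.2 c) (hc a)
    have key : ∀ v ∈ G.V, ⟪G.φ c, v⟫_ℝ ≤ ⟪G.φ a, v⟫_ℝ := by
      intro v hv
      obtain ⟨s₀, hs₀, h⟩ := hdir v hv
      have h1 := (h s₀ hs₀.le le_rfl).2 c
      simp only [inner_add_right, inner_smul_right, hxc] at h1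
      exact le_of_mul_le_mul_left (by linarith) hs₀
    have h1 := key _ (G.sub_mem_V hθ hx.1)
    have h2 := key _ (G.sub_mem_V hx.1 hθ)
    simp only [inner_sub_right] at h1 h2
    linarith

section Finite

variable [Finite A]

theorem inner_le_gap (a b : A) (θ : Vec d) : ⟪G.φ b - G.φ a, θ⟫_ℝ ≤ G.gap a θ :=
  le_ciSup (f := fun b => ⟪G.φ b - G.φ a, θ⟫_ℝ) (Set.finite_range _).bddAbove b

theorem gap_nonneg (a : A) (θ : Vec d) : 0 ≤ G.gap a θ := by
  simpa using G.inner_le_gap a a θ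

variable [Nonempty A]

theorem optimal_nonempty (θ : Vec d) : (G.optimal θ).Nonempty :=
  Finite.exists_max fun b => ⟪G.φ b, θ⟫_ℝ

theorem gap_eq {o : A} {θ : Vec d} (ho : o ∈ G.optimal θ) (a : A) :
    G.gap a θ = ⟪G.φ o, θ⟫_ℝ - ⟪G.φ a, θ⟫_ℝ := by
  refine le_antisymm (ciSup_le fun b => ?_) ?_
  · rw [inner_sub_left]; linarith [ho b]
  · rw [← inner_sub_left]; exact G.inner_le_gap a o θ

theorem gap_eq_zero_iff {a : A} {θ : Vec d} : G.gap a θ = 0 ↔ a ∈ G.optimal θ := by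
  constructor
  · intro h b
    have := G.inner_le_gap a b θ
    rw [inner_sub_left] at this; linarith
  · intro h; rw [G.gap_eq h, sub_self]

theorem continuous_gap (a : A) : Continuous (G.gap a) := by
  cases nonempty_fintype A
  have : G.gap a = fun θ => Finset.univ.sup' Finset.univ_nonempty
      fun b => ⟪G.φ b - G.φ a, θ⟫_ℝ := by
    funext θ; rw [gap, Finset.sup'_univ_eq_ciSup]
  rw [this]
  exact Continuous.finset_sup'_apply _ fun b _ => by fun_prop

end Finite

theorem lineMap_mem_subsingleton (Q : AffineSubspace ℝ (Vec d)) {x y : Vec d}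
    (h : x ∉ Q ∨ y ∉ Q) : {t : ℝ | AffineMap.lineMap x y t ∈ Q}.Subsingleton := by
  intro t ht t' ht'
  by_contra hne
  have hall : ∀ r : ℝ, AffineMap.lineMap x y r ∈ Q := by
    intro r
    have h := AffineMap.lineMap_mem ((r - t) / (t' - t)) ht ht'
    have hd : t' - t ≠ 0 := sub_ne_zero.2 (Ne.symm hne)
    rw [← AffineMap.apply_lineMap] at h
    convert h using 2
    simp only [AffineMap.lineMap_apply, vsub_eq_sub, vadd_eq_add, smul_eq_mul]
    field_simp
    ring
  rcases h with h | h
  · exact h (by simpa using hall 0)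
  · exact h (by simpa using hall 1)

/-- A point of a convex set that avoids finitely many affine subspaces, none of which contains the
set. -/
theorem exists_mem_forall_notMem {C : Set (Vec d)} (hC : Convex ℝ C) (hne : C.Nonempty)
    {ι : Type*} (s : Finset ι) (Q : ι → AffineSubspace ℝ (Vec d))
    (hQ : ∀ i ∈ s, ¬ C ⊆ Q i) : ∃ x ∈ C, ∀ i ∈ s, x ∉ Q i := by
  classical
  induction s using Finset.induction_on with
  | empty => exact ⟨_, hne.some_mem, by simp⟩
  | insert j s hj ih =>
    obtain ⟨x, hx, hxs⟩ := ih fun i hi => hQ i (Finset.mem_insert_of_mem hi)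
    obtain ⟨y, hy, hyj⟩ := Set.not_subset.1 (hQ j (Finset.mem_insert_self _ _))
    -- The line through `x` and `y` is contained in none of the subspaces, so it meets each at most
    -- once.
    have hfin : (⋃ i ∈ insert j s, {t : ℝ | AffineMap.lineMap x y t ∈ Q i}).Finite := by
      refine Set.Finite.biUnion (Finset.finite_toSet _) fun i hi => ?_
      refine (lineMap_mem_subsingleton (Q i) ?_).finite
      rcases Finset.mem_insert.1 hi with rfl | hi
      · exact Or.inr hyj
      · exact Or.inl (hxs i hi)
    obtain ⟨t, ht, htn⟩ := (Set.Icc_infinite (zero_lt_one' ℝ)).exists_notMem_finite hfin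
    refine ⟨AffineMap.lineMap x y t, hC.lineMap_mem hx hy ht, fun i hi hmem => htn ?_⟩
    simp only [Set.mem_iUnion]
    exact ⟨i, hi, hmem⟩

theorem isClosed_optimal (a : A) : IsClosed {θ | a ∈ G.optimal θ} := by
  have : {θ | a ∈ G.optimal θ} = ⋂ b, {θ | ⟪G.φ b, θ⟫_ℝ ≤ ⟪G.φ a, θ⟫_ℝ} := by
    ext; simp [optimal]
  rw [this]
  exact isClosed_iInter fun b => isClosed_le (by fun_prop) (by fun_prop)

section Finite

variable [Finite A] [Nonempty A]

/-- The cells of the Pareto optimal actions cover the parameter set. -/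
theorem exists_pareto_optimal {θ : Vec d} (hθ : θ ∈ G.Θ) : ∃ a ∈ G.pareto, a ∈ G.optimal θ := by
  classical
  cases nonempty_fintype A
  -- `x` avoids the affine hulls of all cells of lower dimension. Near `θ` on the segment towards
  -- `x`, some action is optimal at points accumulating at `θ`; it cannot be one with a
  -- lower-dimensional cell, and it is optimal at `θ` by closedness.
  obtain ⟨x, hx, hxn⟩ := exists_mem_forall_notMem G.convex_Θ G.nonempty_Θ
    (Finset.univ.filter fun a => a ∉ G.pareto) (fun a => affineSpan ℝ (G.cell a)) (by
      intro a ha hsub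
      rw [Finset.mem_filter] at ha
      refine ha.2 (G.mem_pareto_iff.2 ⟨?_, le_antisymm (G.vectorSpan_cell_le a) ?_⟩)
      · rw [← affineSpan_nonempty ℝ]; exact G.nonempty_Θ.mono hsub
      · rw [V_eq, ← direction_affineSpan, ← direction_affineSpan]
        exact AffineSubspace.direction_le (affineSpan_le.2 hsub))
  have hex : ∃ a, ∃ᶠ t in nhdsWithin (0 : ℝ) (Set.Ioi 0),
      a ∈ G.optimal (AffineMap.lineMap θ x t) := by
    by_contra! h
    obtain ⟨t, ht⟩ := (eventually_all.2 h).exists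
    obtain ⟨a, ha⟩ := G.optimal_nonempty (AffineMap.lineMap θ x t)
    exact ht a ha
  obtain ⟨a, ha⟩ := hex
  refine ⟨a, ?_, ?_⟩
  · by_contra hap
    have hxa := hxn a (by simp [hap])
    have hfin := (lineMap_mem_subsingleton (affineSpan ℝ (G.cell a)) (x := θ) (Or.inr hxa)).finite
    have h1 : ∀ᶠ t in nhdsWithin (0 : ℝ) (Set.Ioi 0),
        t ∉ {t : ℝ | AffineMap.lineMap θ x t ∈ affineSpan ℝ (G.cell a)} \ {0} :=
      nhdsWithin_le_nhds ((hfin.sdiff (t := {0})).isClosed.isOpen_compl.mem_nhds (by simp))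
    have h2 : ∀ᶠ t in nhdsWithin (0 : ℝ) (Set.Ioi 0), t ∈ Set.Ioc (0 : ℝ) 1 :=
      Ioc_mem_nhdsGT one_pos
    obtain ⟨t, ht, ht1, ht2⟩ := (ha.and_eventually (h1.and h2)).exists
    exact ht1 ⟨subset_affineSpan ℝ _
      ⟨G.convex_Θ.lineMap_mem hθ hx ⟨ht2.1.le, ht2.2⟩, ht⟩, ht2.1.ne'⟩
  · have hc : Continuous fun t : ℝ => AffineMap.lineMap θ x t := AffineMap.lineMap_continuous
    have := ((G.isClosed_optimal a).preimage hc).mem_of_frequently_of_tendsto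
      (f := id) (b := nhdsWithin (0 : ℝ) (Set.Ioi 0)) (x := 0) ha
      (tendsto_id.mono_left nhdsWithin_le_nhds)
    simpa using this

/-- If the slope in direction `ν` of the optimal actions differs between the end points of a
segment, then there is a point of the segment with two optimal actions of different slopes. -/
theorem exists_slope_ne {x y ν : Vec d} {a b : A} (ha : a ∈ G.optimal x) (hb : b ∈ G.optimal y)
    (h : ⟪G.φ a, ν⟫_ℝ ≠ ⟪G.φ b, ν⟫_ℝ) :
    ∃ θ ∈ segment ℝ x y, ∃ a' ∈ G.optimal θ, ∃ b' ∈ G.optimal θ,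
      ⟪G.φ a', ν⟫_ℝ ≠ ⟪G.φ b', ν⟫_ℝ := by
  have hclosed : ∀ s : Set A, IsClosed (⋃ o ∈ s, {θ | o ∈ G.optimal θ}) := fun s =>
    s.toFinite.isClosed_biUnion fun o _ => G.isClosed_optimal o
  -- The points with an optimal action of the slope of `a`, and those with one of another slope,
  -- form two closed sets covering the connected segment, so they meet on it.
  obtain ⟨θ, hθ, h1, h2⟩ := isPreconnected_closed_iff.1 (convex_segment x y).isPreconnected
    _ _ (hclosed {o | ⟪G.φ o, ν⟫_ℝ = ⟪G.φ a, ν⟫_ℝ}) (hclosed {o | ⟪G.φ o, ν⟫_ℝ ≠ ⟪G.φ a, ν⟫_ℝ})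
    (by
      intro θ _
      obtain ⟨o, ho⟩ := G.optimal_nonempty θ
      simp only [Set.mem_union, Set.mem_iUnion]
      by_cases hoa : ⟪G.φ o, ν⟫_ℝ = ⟪G.φ a, ν⟫_ℝ
      · exact Or.inl ⟨o, hoa, ho⟩
      · exact Or.inr ⟨o, hoa, ho⟩)
    ⟨x, left_mem_segment _ _ _, Set.mem_biUnion (x := a) rfl ha⟩
    ⟨y, right_mem_segment _ _ _, Set.mem_biUnion (x := b) h.symm hb⟩
  simp only [Set.mem_iUnion] at h1 h2
  obtain ⟨a', ha', ha''⟩ := h1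
  obtain ⟨b', hb', hb''⟩ := h2
  exact ⟨θ, hθ, a', ha'', b', hb'', fun h => hb' (h.symm.trans ha')⟩

/-- A relative interior point at which the actions optimal there are in `S`, and the maximal reward
has a kink in direction `ν`. -/
theorem exists_kink (S : Set A) {a b : A} (ha : a ∈ G.pareto) (hb : b ∈ G.pareto) {ν z : Vec d}
    (hab : ⟪G.φ a, ν⟫_ℝ ≠ ⟪G.φ b, ν⟫_ℝ) (hz : z ∈ G.Θ)
    (hzS : ∀ c ∉ S, ⟪G.φ c, z⟫_ℝ < ⟪G.φ a, z⟫_ℝ ∧ ⟪G.φ c, z⟫_ℝ < ⟪G.φ b, z⟫_ℝ) :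
    ∃ θ ∈ core G.Θ, G.optimal θ ⊆ S ∧ ∃ a' ∈ G.optimal θ, ∃ b' ∈ G.optimal θ,
      ⟪G.φ a', ν⟫_ℝ < ⟪G.φ b', ν⟫_ℝ := by
  obtain ⟨x, hx, hxa, hxo⟩ := G.exists_core_of_pareto ha
  obtain ⟨y, hy, hyb, hyo⟩ := G.exists_core_of_pareto hb
  -- Otherwise `c` would be a duplicate of `a` on Θ, contradicting strictness at `z`.
  have hxS : ∀ c ∉ S, ⟪G.φ c, x⟫_ℝ < ⟪G.φ a, x⟫_ℝ := fun c hc => by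
    by_contra! h
    have := hxo c (fun e => (hxa e).trans h) z hz
    exact (hzS c hc).1.ne this
  have hyS : ∀ c ∉ S, ⟪G.φ c, y⟫_ℝ < ⟪G.φ b, y⟫_ℝ := fun c hc => by
    by_contra! h
    have := hyo c (fun e => (hyb e).trans h) z hz
    exact (hzS c hc).2.ne this
  -- move `z` into the relative interior
  obtain ⟨z', hz', hz'S⟩ : ∃ z' ∈ core G.Θ, ∀ c ∉ S,
      ⟪G.φ c, z'⟫_ℝ < ⟪G.φ a, z'⟫_ℝ ∧ ⟪G.φ c, z'⟫_ℝ < ⟪G.φ b, z'⟫_ℝ := by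
    have hc : Continuous fun t : ℝ => t • x + (1 - t) • z := by fun_prop
    have hev : ∀ᶠ t in nhds (0 : ℝ), ∀ c : A, c ∉ S →
        ⟪G.φ c, t • x + (1 - t) • z⟫_ℝ < ⟪G.φ a, t • x + (1 - t) • z⟫_ℝ ∧
        ⟪G.φ c, t • x + (1 - t) • z⟫_ℝ < ⟪G.φ b, t • x + (1 - t) • z⟫_ℝ := by
      refine eventually_all.2 fun c => ?_
      by_cases hcS : c ∈ S
      · simp [hcS]
      · have h1 : ∀ e : A, ⟪G.φ c, z⟫_ℝ < ⟪G.φ e, z⟫_ℝ → ∀ᶠ t in nhds (0 : ℝ),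
            ⟪G.φ c, t • x + (1 - t) • z⟫_ℝ < ⟪G.φ e, t • x + (1 - t) • z⟫_ℝ := fun e he =>
          ContinuousAt.eventually_lt (by fun_prop) (by fun_prop) (by simpa using he)
        filter_upwards [h1 a (hzS c hcS).1, h1 b (hzS c hcS).2] with t h1 h2 _ using ⟨h1, h2⟩
    have h2 : ∀ᶠ t in nhdsWithin (0 : ℝ) (Set.Ioi 0), t ∈ Set.Ioc (0 : ℝ) 1 :=
      Ioc_mem_nhdsGT one_pos
    obtain ⟨t, ht, ht2⟩ := ((hev.filter_mono nhdsWithin_le_nhds).and h2).exists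
    exact ⟨_, core_combo G.convex_Θ hx hz ht2.1 (sub_nonneg.2 ht2.2) (by ring), ht⟩
  have key : ∀ (e o : A) (w : Vec d), w ∈ core G.Θ → (∀ c ∉ S, ⟪G.φ c, w⟫_ℝ < ⟪G.φ e, w⟫_ℝ) →
      (∀ c ∉ S, ⟪G.φ c, z'⟫_ℝ < ⟪G.φ e, z'⟫_ℝ) → e ∈ G.optimal w → o ∈ G.optimal z' →
      ⟪G.φ e, ν⟫_ℝ ≠ ⟪G.φ o, ν⟫_ℝ →
      ∃ θ ∈ core G.Θ, G.optimal θ ⊆ S ∧ ∃ a' ∈ G.optimal θ, ∃ b' ∈ G.optimal θ,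
        ⟪G.φ a', ν⟫_ℝ < ⟪G.φ b', ν⟫_ℝ := by
    intro e o w hw hwS hzS he ho hne
    obtain ⟨θ, hθ, a', ha', b', hb', hne'⟩ := G.exists_slope_ne he ho hne
    -- `e` strictly beats each action outside `S` at both end points, hence on the whole segment by
    -- linearity.
    refine ⟨θ, (convex_core G.convex_Θ).segment_subset hw hz' hθ, fun c hc => ?_, ?_⟩
    · by_contra hcS
      obtain ⟨p, q, hp, hq, hpq, rfl⟩ := hθ
      have h3 := hc e
      simp only [inner_add_right, inner_smul_right] at h3
      have h1 := hwS c hcS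
      have h2 := hzS c hcS
      rcases hp.eq_or_lt with rfl | hp
      · obtain rfl : q = 1 := by linarith
        linarith
      · have := mul_lt_mul_of_pos_left h1 hp
        have := mul_le_mul_of_nonneg_left h2.le hq
        linarith
    · rcases lt_or_gt_of_ne hne' with h | h
      · exact ⟨a', ha', b', hb', h⟩
      · exact ⟨b', hb', a', ha', h⟩
  obtain ⟨o, ho⟩ := G.optimal_nonempty z'
  -- The slopes of `a` and `b` differ, so at least one of them differs from that of `o`; the segment
  -- from the corresponding point to `z'` carries the kink.
  by_cases hao : ⟪G.φ a, ν⟫_ℝ = ⟪G.φ o, ν⟫_ℝ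
  · exact key b o y hy hyS (fun c hc => (hz'S c hc).2) hyb ho (fun h => hab (hao.trans h.symm))
  · exact key a o x hx hxS (fun c hc => (hz'S c hc).1) hxa ho hao

end Finite
end Game

/-! ### Linear estimation from observation maps. -/

namespace Game

variable {A : Type*} {d m : ℕ} (G : Game A d m)

/-- A functional that vanishes on the common kernel of the maps `M c`, `c ∈ S`, is a combination of
these maps. -/
theorem exists_inner_eq_sum (S : Finset A) (u : Vec d)
    (h : ∀ ν ∈ G.V, (∀ c ∈ S, G.M c ν = 0) → ⟪u, ν⟫_ℝ = 0) :
    ∃ r ∈ G.V, ∀ ν ∈ G.V, ⟪u, ν⟫_ℝ = ∑ c ∈ S, ⟪G.M c r, G.M c ν⟫_ℝ := by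
  let T : Vec d →ₗ[ℝ] Vec d := G.V.starProjection.toLinearMap ∘ₗ
    (∑ c ∈ S, (ContinuousLinearMap.adjoint (G.M c) ∘L G.M c).toLinearMap) ∘ₗ
      G.V.starProjection.toLinearMap
  have hT : ∀ x y, ⟪T x, y⟫_ℝ =
      ∑ c ∈ S, ⟪G.M c (G.V.starProjection x), G.M c (G.V.starProjection y)⟫_ℝ := by
    intro x y
    simp only [T, LinearMap.comp_apply, ContinuousLinearMap.coe_coe, LinearMap.sum_apply]
    rw [Submodule.inner_starProjection_left_eq_right, sum_inner]
    simp [ContinuousLinearMap.adjoint_inner_left]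
  have hsymm : T.IsSymmetric := by
    intro x y
    rw [hT, real_inner_comm, hT]
    exact Finset.sum_congr rfl fun c _ => real_inner_comm _ _
  have hPV : ∀ ν ∈ G.V, G.V.starProjection ν = ν := fun ν hν =>
    Submodule.starProjection_eq_self_iff.2 hν
  -- `T` is symmetric, so its range is the orthogonal complement of its kernel; on the kernel the
  -- sum of squares ⟪Tν, ν⟫ vanishes, hence so does each term.
  have hmem : G.V.starProjection u ∈ LinearMap.range T := by
    rw [← Submodule.orthogonal_orthogonal (LinearMap.range T), hsymm.orthogonal_range,
      Submodule.mem_orthogonal]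
    intro ν hν
    have h0 : ∑ c ∈ S, ‖G.M c (G.V.starProjection ν)‖ ^ 2 = 0 := by
      have := hT ν ν
      rw [LinearMap.mem_ker.1 hν, inner_zero_left] at this
      simpa only [real_inner_self_eq_norm_sq] using this.symm
    rw [Finset.sum_eq_zero_iff_of_nonneg fun _ _ => sq_nonneg _] at h0
    rw [real_inner_comm, Submodule.inner_starProjection_left_eq_right]
    exact h _ (Submodule.starProjection_apply_mem _ _) fun c hc => by simpa using h0 c hc
  obtain ⟨r, hr⟩ := hmem
  refine ⟨G.V.starProjection r, Submodule.starProjection_apply_mem _ _, fun ν hν => ?_⟩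
  have h1 := hT r ν
  rw [hPV ν hν, hr, Submodule.inner_starProjection_left_eq_right, hPV ν hν] at h1
  exact h1

theorem exists_sq_inner_le (S : Finset A) (u : Vec d)
    (h : ∀ ν ∈ G.V, (∀ c ∈ S, G.M c ν = 0) → ⟪u, ν⟫_ℝ = 0) :
    ∃ C : ℝ, 0 ≤ C ∧ ∀ ν ∈ G.V, ⟪u, ν⟫_ℝ ^ 2 ≤ C * ∑ c ∈ S, ‖G.M c ν‖ ^ 2 := by
  obtain ⟨r, -, hr⟩ := G.exists_inner_eq_sum S u h
  refine ⟨∑ c ∈ S, ‖G.M c r‖ ^ 2, Finset.sum_nonneg fun _ _ => sq_nonneg _, fun ν hν => ?_⟩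
  rw [hr ν hν]
  refine le_trans ?_ (Finset.sum_mul_sq_le_sq_mul_sq S _ _)
  rw [sq_le_sq]
  refine (Finset.abs_sum_le_sum_abs _ _).trans (le_trans ?_ (le_abs_self _))
  exact Finset.sum_le_sum fun c _ => abs_real_inner_le_norm _ _

/-- Estimation of a linear functional on `V`: weights of small norm. -/
theorem exists_weights (S : Finset A) (u : Vec d) {x : ℝ} (hx : 0 ≤ x)
    (h : ∀ ν ∈ G.V, ⟪u, ν⟫_ℝ ^ 2 ≤ x * ∑ c ∈ S, ‖G.M c ν‖ ^ 2) :
    ∃ w : A → Vec m, (∀ ν ∈ G.V, ∑ c ∈ S, ⟪w c, G.M c ν⟫_ℝ = ⟪u, ν⟫_ℝ) ∧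
      ∑ c ∈ S, ‖w c‖ ^ 2 ≤ x := by
  obtain ⟨r, hrV, hr⟩ := G.exists_inner_eq_sum S u fun ν hν h0 => by
    have := h ν hν
    rw [Finset.sum_eq_zero (fun c hc => by rw [h0 c hc]; simp), mul_zero] at this
    exact pow_eq_zero_iff two_ne_zero |>.1 (le_antisymm this (sq_nonneg _))
  -- With weights `M c r` the squared norms sum to ⟪u, r⟫. Testing the hypothesis at `ν = r` bounds
  -- the square of this sum by `x` times the sum.
  have h1 := h r hrV
  have h2 := hr r hrV
  simp only [real_inner_self_eq_norm_sq] at h2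
  rw [h2] at h1
  rcases (Finset.sum_nonneg fun c (_ : c ∈ S) => sq_nonneg ‖G.M c r‖).eq_or_lt with h0 | h0
  · exact ⟨fun c => G.M c r, fun ν hν => (hr ν hν).symm, h0 ▸ hx⟩
  · exact ⟨fun c => G.M c r, fun ν hν => (hr ν hν).symm, by
      rw [sq] at h1; exact le_of_mul_le_mul_right h1 h0⟩

/-! ### Observability and kernels -/

theorem IsGloballyObservable.inner_eq_zero (hG : G.IsGloballyObservable) {a b : A}
    (ha : a ∈ G.pareto) (hb : b ∈ G.pareto) {ν : Vec d} (hν : ν ∈ G.V)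
    (h : ∀ c, G.M c ν = 0) : ⟪G.φ a - G.φ b, ν⟫_ℝ = 0 := by
  have h1 := hG a ha b hb
  have h2 : ∀ v, ⟪G.V.starProjection v, ν⟫_ℝ = ⟪v, ν⟫_ℝ := fun v => by
    rw [Submodule.inner_starProjection_left_eq_right, Submodule.starProjection_eq_self_iff.2 hν]
  rw [← h2]
  generalize G.V.starProjection (G.φ a - G.φ b) = p at h1
  induction h1 using Submodule.span_induction with
  | mem v hv =>
    obtain ⟨c, w, rfl⟩ := hv
    rw [h2, ContinuousLinearMap.adjoint_inner_left, h, inner_zero_right]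
  | zero => simp
  | add v w _ _ hv hw => rw [inner_add_left, hv, hw, add_zero]
  | smul r v _ hv => rw [inner_smul_left, hv, mul_zero]

theorem mem_extPlausible_of_mem_plausible {E : Set (Vec d)} {η : ℝ≥0} (hη : 1 ≤ η) {a : A}
    (ha : a ∈ G.plausible E) : a ∈ G.extPlausible η E := by
  refine (le_iSup₂ (f := fun b (_ : b ∈ G.plausible E) => G.maxGap E b) a ha).trans ?_
  exact le_mul_of_one_le_left' (by exact_mod_cast hη)

variable [Finite A]

/-- For fixed `η`, `alignAt` depends on `E` only through two subsets of the finite set `A`, so it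
takes finitely many values. If all were finite, `η ^ 2` times the largest would bound `align`
uniformly. -/
theorem exists_alignAt_eq_top (h : ¬ G.IsLocallyObservable) {η : ℝ≥0} (hη : 0 < η) :
    ∃ E ⊆ G.Θ, G.alignAt η E = ∞ := by
  by_contra! hno
  refine h ?_
  let F : Set A × Set A → ℝ≥0∞ := fun q =>
    ⨆ ν ∈ G.V, ⨆ a ∈ q.1, ⨆ b ∈ q.1, ⨅ c ∈ q.2,
      ENNReal.ofReal (⟪G.φ a - G.φ b, ν⟫_ℝ ^ 2) / ENNReal.ofReal (‖G.M c ν‖ ^ 2)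
  have hfin : (G.alignAt η '' {E | E ⊆ G.Θ}).Finite := by
    refine (Set.finite_range F).subset ?_
    rintro _ ⟨E, -, rfl⟩
    exact ⟨(G.plausible E, G.extPlausible η E), rfl⟩
  obtain ⟨E₀, hE₀, hmax⟩ := Set.Finite.exists_maximalFor' (G.alignAt η) {E | E ⊆ G.Θ} hfin
    ⟨∅, Set.empty_subset _⟩
  have hmax' : ∀ E ⊆ G.Θ, G.alignAt η E ≤ G.alignAt η E₀ := fun E hE =>
    (le_total _ _).elim id fun h => hmax hE h
  refine lt_of_le_of_lt (b := (η : ℝ≥0∞) ^ 2 * G.alignAt η E₀) (iSup₂_le fun E hE => ?_) ?_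
  · exact (iInf₂_le η hη).trans (mul_le_mul_right (hmax' E hE) _)
  · exact ENNReal.mul_lt_top (by finiteness) (hno E₀ hE₀).lt_top

/-- If the common kernel of the extended plausible actions annihilated all plausible differences,
these would be dominated by the sum of the ‖M_c ν‖², hence by `card A` times the largest, which
would bound `alignAt`. The assumption `1 ≤ η` makes the extended set contain the plausible one. -/
theorem exists_of_alignAt_eq_top {E : Set (Vec d)} {η : ℝ≥0} (hη : 1 ≤ η)
    (h : G.alignAt η E = ∞) : ∃ a ∈ G.plausible E, ∃ b ∈ G.plausible E, ∃ ν ∈ G.V,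
      (∀ c ∈ G.extPlausible η E, G.M c ν = 0) ∧ ⟪G.φ a - G.φ b, ν⟫_ℝ ≠ 0 := by
  classical
  cases nonempty_fintype A
  by_contra! hno
  set S := (G.extPlausible η E).toFinset with hS
  have hex : ∀ p : A × A, ∃ C : ℝ, 0 ≤ C ∧ (p.1 ∈ G.plausible E → p.2 ∈ G.plausible E →
      ∀ ν ∈ G.V, ⟪G.φ p.1 - G.φ p.2, ν⟫_ℝ ^ 2 ≤ C * ∑ c ∈ S, ‖G.M c ν‖ ^ 2) := by
    intro p
    by_cases hp : p.1 ∈ G.plausible E ∧ p.2 ∈ G.plausible E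
    · obtain ⟨C, hC, h⟩ := G.exists_sq_inner_le S (G.φ p.1 - G.φ p.2) fun ν hν h0 =>
        hno _ hp.1 _ hp.2 ν hν fun c hc => h0 c (by simpa [hS] using hc)
      exact ⟨C, hC, fun _ _ => h⟩
    · exact ⟨0, le_rfl, fun h1 h2 => (hp ⟨h1, h2⟩).elim⟩
  choose C hC0 hC using hex
  have hle : G.alignAt η E ≤ ENNReal.ofReal ((∑ p, C p) * Fintype.card A) := by
    refine iSup₂_le fun ν hν => iSup₂_le fun a ha => iSup₂_le fun b hb => ?_
    have hSne : S.Nonempty := ⟨a, by simpa [hS] using G.mem_extPlausible_of_mem_plausible hη ha⟩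
    obtain ⟨c, hc, hmax⟩ := S.exists_max_image (fun c => ‖G.M c ν‖ ^ 2) hSne
    refine (iInf₂_le c (by simpa [hS] using hc)).trans ?_
    refine ENNReal.div_le_of_le_mul ?_
    rw [← ENNReal.ofReal_mul (mul_nonneg (Finset.sum_nonneg fun p _ => hC0 p) (Nat.cast_nonneg _))]
    refine ENNReal.ofReal_le_ofReal ((hC (a, b) ha hb ν hν).trans ?_)
    rw [mul_assoc]
    refine mul_le_mul (Finset.single_le_sum (fun p _ => hC0 p) (Finset.mem_univ (a, b))) ?_
      (Finset.sum_nonneg fun _ _ => sq_nonneg _) (Finset.sum_nonneg fun p _ => hC0 p)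
    refine (Finset.sum_le_card_nsmul _ _ _ hmax).trans ?_
    rw [nsmul_eq_mul]
    exact mul_le_mul_of_nonneg_right (by exact_mod_cast Finset.card_le_univ S) (sq_nonneg _)
  rw [h] at hle
  exact ENNReal.ofReal_ne_top (top_le_iff.1 hle)

/-! ### Existence of kinks with little information. -/

variable [Nonempty A]

/-- A kink of the maximal reward: a relative interior point `θ` with optimal actions of different
slopes in the direction `ν`. -/
def IsKink (θ ν : Vec d) : Prop :=
  θ ∈ core G.Θ ∧ ν ∈ G.V ∧ ∃ a ∈ G.optimal θ, ∃ b ∈ G.optimal θ, ⟪G.φ a, ν⟫_ℝ < ⟪G.φ b, ν⟫_ℝ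

/-- Without kinks all Pareto optimal actions have the same slope along every `θ - θ₀`, so a Pareto
action optimal at `θ₀` is optimal everywhere. -/
theorem exists_isKink_of_not_isTrivial (h : ¬ G.IsTrivial) : ∃ θ ν, G.IsKink θ ν := by
  by_contra! hno
  obtain ⟨θ₀, hθ₀⟩ := G.nonempty_Θ
  obtain ⟨a, ha, hao⟩ := G.exists_pareto_optimal hθ₀
  refine h ⟨a, Set.Subset.antisymm (fun _ h => h.1) fun θ hθ => ⟨hθ, ?_⟩⟩
  obtain ⟨b, hb, hbo⟩ := G.exists_pareto_optimal hθ
  have hV := G.sub_mem_V hθ hθ₀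
  have : ⟪G.φ a, θ - θ₀⟫_ℝ = ⟪G.φ b, θ - θ₀⟫_ℝ := by
    by_contra hne
    obtain ⟨x, hx, -, a', ha', b', hb', hlt⟩ :=
      G.exists_kink Set.univ ha hb hne hθ₀ (fun c hc => (hc trivial).elim)
    exact hno x _ ⟨hx, hV, a', ha', b', hb', hlt⟩
  simp only [inner_sub_right] at this
  intro c
  linarith [hbo c, hao b]

theorem exists_isKink_of_isHopeless (h : G.IsHopeless) :
    ∃ θ ν, G.IsKink θ ν ∧ ∀ c, G.M c ν = 0 := by
  simp only [IsHopeless, IsGloballyObservable, not_forall] at h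
  obtain ⟨a, ha, b, hb, hn⟩ := h
  set W := Submodule.span ℝ {v | ∃ (c : A) (w : Vec m),
        v = G.V.starProjection (ContinuousLinearMap.adjoint (G.M c) w)} with hW
  -- Failure of membership in a span is detected by a vector of the orthogonal complement; its
  -- projection to `V` is the invisible direction.
  obtain ⟨u, hu, hne⟩ : ∃ u ∈ Wᗮ, ⟪u, G.V.starProjection (G.φ a - G.φ b)⟫_ℝ ≠ 0 := by
    by_contra! hall
    refine hn ?_
    rw [← Submodule.orthogonal_orthogonal W, Submodule.mem_orthogonal]
    exact hall
  rw [← Submodule.inner_starProjection_left_eq_right] at hne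
  have hM : ∀ c, G.M c (G.V.starProjection u) = 0 := by
    intro c
    refine ext_inner_left ℝ fun w => ?_
    rw [inner_zero_right, ← ContinuousLinearMap.adjoint_inner_left,
      ← Submodule.inner_starProjection_left_eq_right]
    exact (Submodule.mem_orthogonal _ _).1 hu _ (Submodule.subset_span ⟨c, w, rfl⟩)
  have hV : G.V.starProjection u ∈ G.V := Submodule.starProjection_apply_mem _ _
  obtain ⟨x, hx, -, a', ha', b', hb', hlt⟩ := G.exists_kink Set.univ ha hb
    (ν := G.V.starProjection u) (fun e => hne (by
      rw [real_inner_comm, inner_sub_left, e, sub_self])) G.nonempty_Θ.some_mem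
    (fun c hc => (hc trivial).elim)
  exact ⟨x, _, ⟨hx, hV, a', ha', b', hb', hlt⟩, hM⟩

/-- The level `η = card A` allows averaging: each action outside the extended plausible set has a
witness in `E` where its gap exceeds `card A` times the largest plausible gap. At the mean of the
witnesses all plausible actions strictly beat all those actions, which is what `exists_kink` needs
to keep the optimal set inside the extended plausible set. -/
theorem exists_isKink_of_not_isLocallyObservable (h : ¬ G.IsLocallyObservable) :
    ∃ θ ν, G.IsKink θ ν ∧ ∀ c ∈ G.optimal θ, G.M c ν = 0 := by
  classical
  cases nonempty_fintype A
  have hη : (1 : ℝ≥0) ≤ Fintype.card A := by exact_mod_cast Fintype.card_pos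
  obtain ⟨E, hE, htop⟩ := G.exists_alignAt_eq_top h (zero_lt_one.trans_le hη)
  obtain ⟨a, ha, b, hb, ν, hν, hM, hne⟩ := G.exists_of_alignAt_eq_top hη htop
  set S := G.extPlausible (Fintype.card A : ℝ≥0) E with hS
  set D : ℝ≥0∞ := ⨆ b ∈ G.plausible E, G.maxGap E b with hD
  obtain ⟨ha', θa, hθa, ha0⟩ := ha
  have hwit : ∀ c, ∃ θ ∈ E, c ∉ S → (Fintype.card A : ℝ≥0∞) * D < ENNReal.ofReal (G.gap c θ) := by
    intro c
    by_cases hc : c ∈ S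
    · exact ⟨θa, hθa, fun h => (h hc).elim⟩
    · have : (Fintype.card A : ℝ≥0∞) * D < G.maxGap E c := by
        simpa [S, extPlausible] using hc
      obtain ⟨θ, hθ⟩ := lt_iSup_iff.1 this
      obtain ⟨hθE, hlt⟩ := lt_iSup_iff.1 hθ
      exact ⟨θ, hθE, fun _ => hlt⟩
  choose θ hθE hθ using hwit
  set z : Vec d := ∑ i, (Fintype.card A : ℝ)⁻¹ • θ i with hz
  have hcard : (0 : ℝ) < Fintype.card A := by exact_mod_cast Fintype.card_pos
  have hzΘ : z ∈ G.Θ := G.convex_Θ.sum_mem (fun _ _ => by positivity)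
    (by simp [hcard.ne']) fun i _ => hE (hθE i)
  have hz' : ∀ e ∈ G.plausible E, ∀ c ∉ S, ⟪G.φ c, z⟫_ℝ < ⟪G.φ e, z⟫_ℝ := by
    intro e he c hc
    have hlt := hθ c hc
    have hDtop : D ≠ ∞ := by
      rintro hD'
      rw [hD', ENNReal.mul_top (by exact_mod_cast Fintype.card_ne_zero)] at hlt
      exact not_top_lt hlt
    have hgap : ∀ i, G.gap e (θ i) ≤ D.toReal := fun i => by
      rw [← ENNReal.ofReal_le_iff_le_toReal hDtop]
      exact (le_iSup₂ (f := fun θ (_ : θ ∈ E) => ENNReal.ofReal (G.gap e θ)) (θ i) (hθE i)).trans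
        (le_iSup₂ (f := fun b (_ : b ∈ G.plausible E) => G.maxGap E b) e he)
    have hlt' : Fintype.card A * D.toReal < G.gap c (θ c) := by
      have := (ENNReal.lt_ofReal_iff_toReal_lt hlt.ne_top).1 hlt
      simpa using this
    have hterm : ∀ i, ⟪G.φ e - G.φ c, θ i⟫_ℝ = G.gap c (θ i) - G.gap e (θ i) := fun i => by
      obtain ⟨o, ho⟩ := G.optimal_nonempty (θ i)
      rw [G.gap_eq ho, G.gap_eq ho, inner_sub_left]; ring
    -- Each summand is nonnegative because `e` has gap at most `D`; the one at the witness of `c`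
    -- already exceeds the left side.
    have hsum : Fintype.card A * D.toReal < ∑ i, (⟪G.φ e - G.φ c, θ i⟫_ℝ + D.toReal) := by
      refine lt_of_lt_of_le ?_ (Finset.single_le_sum (f := fun i =>
        ⟪G.φ e - G.φ c, θ i⟫_ℝ + D.toReal) (fun i _ => ?_) (Finset.mem_univ c))
      · have := hgap c
        simp only [hterm]; linarith
      · have h1 := hgap i
        have h2 := G.gap_nonneg c (θ i)
        simp only [hterm]; linarith
    rw [Finset.sum_add_distrib, Finset.sum_const, Finset.card_univ, nsmul_eq_mul] at hsum
    have hpos : 0 < ⟪G.φ e - G.φ c, z⟫_ℝ := by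
      rw [hz, ← Finset.smul_sum, inner_smul_right, inner_sum]
      exact mul_pos (by positivity) (by linarith)
    rw [inner_sub_left] at hpos; linarith
  obtain ⟨x, hx, hxS, a', hao, b', hbo, hlt⟩ := G.exists_kink S ha' hb.1 (ν := ν)
    (fun e => hne (by rw [inner_sub_left, e, sub_self])) hzΘ
    (fun c hc => ⟨hz' a ⟨ha', θa, hθa, ha0⟩ c hc, hz' b hb c hc⟩)
  exact ⟨x, ν, ⟨hx, hν, a', hao, b', hbo, hlt⟩, fun c hc => hM c (hxS hc)⟩

end Game

/-! ### Laws of histories. -/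

section Law

set_option linter.unusedSectionVars false

variable {A : Type*} [Finite A] [MeasurableSpace A] [MeasurableSingletonClass A] {d m : ℕ}
  (G : Game A d m) (π : Policy A m) (θ : Vec d) (ξ : Noise A m)

/-- Extension of a history by one round. -/
abbrev ext {t : ℕ} (h : Hist A m t) (p : A × Vec m) : Hist A m (t + 1) :=
  Fin.snoc (α := fun _ => A × Vec m) h p

theorem lintegral_histLaw_succ {t : ℕ} {F : Hist A m (t + 1) → ℝ≥0∞} (hF : Measurable F) :
    ∫⁻ h, F h ∂(histLaw G π θ ξ (t + 1)) =
      ∫⁻ h, ∫⁻ a, ∫⁻ e, F (ext h (a, G.M a θ + e)) ∂(ξ.law t (h, a)) ∂(π.act t h)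
        ∂(histLaw G π θ ξ t) := by
  have hF' : Measurable fun p : Hist A m t × (A × Vec m) => F (ext p.1 p.2) :=
    hF.comp (measurable_snoc t)
  rw [histLaw, lintegral_map hF (measurable_snoc t), Measure.lintegral_compProd hF']
  refine lintegral_congr fun h => ?_
  have hFh : Measurable fun p : A × Vec m => F (ext h p) := hF'.comp measurable_prodMk_left
  rw [stepKernel, Kernel.lintegral_map _ (measurable_obs G θ) _ hFh]
  exact Kernel.lintegral_compProd _ _ _ (hFh.comp (measurable_obs G θ))

variable {θ ξ} in
theorem measurable_ext_obs (t : ℕ) :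
    Measurable fun p : (Hist A m t × A) × Vec m => ext p.1.1 (p.1.2, G.M p.1.2 θ + p.2) := by
  have h := (measurable_obs (m := m) G θ).comp
    ((measurable_snd.comp measurable_fst).prodMk measurable_snd :
      Measurable fun p : (Hist A m t × A) × Vec m => (p.1.2, p.2))
  exact (measurable_snoc t).comp ((measurable_fst.comp measurable_fst).prodMk h)

theorem integrable_actions {n : ℕ} (f : (Fin n → A) → ℝ) :
    Integrable (fun h => f fun t => (h t).1) (histLaw G π θ ξ n) := by
  have hm : Measurable fun h : Hist A m n => f fun t => (h t).1 :=
    (measurable_of_finite f).comp (by fun_prop)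
  obtain ⟨C, hC⟩ := (Set.finite_range fun x => ‖f x‖).bddAbove
  exact Integrable.of_bound hm.aestronglyMeasurable C
    (Eventually.of_forall fun h => hC ⟨_, rfl⟩)

/-- The sum of the gaps of the actions played. -/
def cumGap {n : ℕ} (h : Hist A m n) : ℝ := ∑ t, G.gap (h t).1 θ

theorem cumGap_nonneg {n : ℕ} (h : Hist A m n) : 0 ≤ cumGap G θ h :=
  Finset.sum_nonneg fun _ _ => G.gap_nonneg _ _

theorem measurable_cumGap (n : ℕ) : Measurable (cumGap (m := m) G θ (n := n)) :=
  Finset.measurable_sum _ fun t _ =>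
    (measurable_of_finite fun a => G.gap a θ).comp (by fun_prop)

theorem cumGap_ext {t : ℕ} (h : Hist A m t) (p : A × Vec m) :
    cumGap G θ (ext h p) = cumGap G θ h + G.gap p.1 θ := by
  simp [cumGap, Fin.sum_univ_castSucc, ext]

/-! ### Exponential supermartingales -/

variable {ξ} in
theorem Noise.IsSubGaussian.lintegral_exp_le {ρ : ℝ} (hξ : ξ.IsSubGaussian ρ) {t : ℕ}
    (x : Hist A m t × A) (u : Vec m) :
    ∫⁻ e, ENNReal.ofReal (Real.exp (⟪u, e⟫_ℝ - ρ ^ 2 / 2 * ‖u‖ ^ 2)) ∂(ξ.law t x) ≤ 1 := by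
  obtain ⟨-, -, h⟩ := hξ t x
  obtain ⟨hi, hle⟩ := h u
  simp_rw [Real.exp_sub]
  rw [← ofReal_integral_eq_lintegral_ofReal (hi.div_const _)
    (Eventually.of_forall fun e => by positivity), integral_div]
  rw [ENNReal.ofReal_le_one, div_le_one (Real.exp_pos _)]
  exact hle.trans_eq (by congr 1; ring)

/-- The exponent of the exponential martingale with the weights `W`. -/
def expo (W : (t : ℕ) → Hist A m t × A → Vec m) (ρ : ℝ) : (n : ℕ) → Hist A m n → ℝ
  | 0, _ => 0
  | n + 1, h =>
    let h' : Hist A m n := Fin.init (α := fun _ => A × Vec m) h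
    let p := h (Fin.last n)
    expo W ρ n h' + (⟪W n (h', p.1), p.2 - G.M p.1 θ⟫_ℝ - ρ ^ 2 / 2 * ‖W n (h', p.1)‖ ^ 2)

theorem expo_ext (W : (t : ℕ) → Hist A m t × A → Vec m) (ρ : ℝ) {n : ℕ} (h : Hist A m n)
    (p : A × Vec m) : expo G θ W ρ (n + 1) (ext h p) =
      expo G θ W ρ n h + (⟪W n (h, p.1), p.2 - G.M p.1 θ⟫_ℝ - ρ ^ 2 / 2 * ‖W n (h, p.1)‖ ^ 2) := by
  simp [expo, ext]

theorem measurable_init (n : ℕ) : Measurable fun h : Hist A m (n + 1) =>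
    (Fin.init (α := fun _ => A × Vec m) h : Hist A m n) :=
  measurable_pi_lambda _ fun _ => measurable_pi_apply _

theorem measurable_expo {W : (t : ℕ) → Hist A m t × A → Vec m} (hW : ∀ t, Measurable (W t))
    (ρ : ℝ) (n : ℕ) : Measurable (expo G θ W ρ n) := by
  induction n with
  | zero => exact measurable_const
  | succ n ih =>
    have h1 := measurable_init (A := A) (m := m) n
    have hl : Measurable fun h : Hist A m (n + 1) => h (Fin.last n) := measurable_pi_apply _
    have h2 : Measurable fun h : Hist A m (n + 1) =>
        W n (Fin.init (α := fun _ => A × Vec m) h, (h (Fin.last n)).1) :=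
      (hW n).comp (h1.prodMk (measurable_fst.comp hl))
    have h3 : Measurable fun h : Hist A m (n + 1) =>
        (h (Fin.last n)).2 - G.M (h (Fin.last n)).1 θ :=
      (measurable_snd.comp hl).sub
        ((measurable_of_finite fun a => G.M a θ).comp (measurable_fst.comp hl))
    exact (ih.comp h1).add ((h2.inner h3).sub ((h2.norm.pow_const 2).const_mul _))

variable {ξ} in
-- The weight is fixed by the history and the action, so each new factor has conditional mean at
-- most 1, whatever the policy.
theorem lintegral_exp_expo_le {ρ : ℝ} (hξ : ξ.IsSubGaussian ρ)
    {W : (t : ℕ) → Hist A m t × A → Vec m} (hW : ∀ t, Measurable (W t)) (n : ℕ) :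
    ∫⁻ h, ENNReal.ofReal (Real.exp (expo G θ W ρ n h)) ∂(histLaw G π θ ξ n) ≤ 1 := by
  induction n with
  | zero => simp [expo]
  | succ n ih =>
    rw [lintegral_histLaw_succ]
    swap
    · exact (Real.measurable_exp.comp (measurable_expo G θ hW ρ (n + 1))).ennreal_ofReal
    refine le_trans (lintegral_mono fun h => ?_) ih
    have : ∀ a, ∫⁻ e, ENNReal.ofReal (Real.exp (expo G θ W ρ (n + 1)
        (ext h (a, G.M a θ + e)))) ∂(ξ.law n (h, a)) ≤
        ENNReal.ofReal (Real.exp (expo G θ W ρ n h)) := by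
      intro a
      simp_rw [expo_ext, add_sub_cancel_left, Real.exp_add,
        ENNReal.ofReal_mul (Real.exp_pos (expo G θ W ρ n h)).le]
      rw [lintegral_const_mul' _ _ ENNReal.ofReal_ne_top]
      exact mul_le_of_le_one_right' (hξ.lintegral_exp_le (h, a) _)
    refine (lintegral_mono fun a => this a).trans ?_
    simp

/-! ### Regret as an expected sum of gaps -/

variable [Nonempty A]

theorem regret_eq (n : ℕ) :
    regret G π θ ξ n = ∫ h, cumGap G θ h ∂(histLaw G π θ ξ n) := by
  have hint := integrable_actions G π θ ξ (n := n)
  refine le_antisymm (ciSup_le fun a => ?_) ?_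
  · refine integral_mono (hint fun x => ∑ t, ⟪G.φ a - G.φ (x t), θ⟫_ℝ)
      (hint fun x => ∑ t, G.gap (x t) θ) fun h => ?_
    exact Finset.sum_le_sum fun t _ => G.inner_le_gap _ _ _
  · obtain ⟨o, ho⟩ := G.optimal_nonempty θ
    refine le_trans (le_of_eq ?_) (le_ciSup (Set.finite_range _).bddAbove o)
    refine integral_congr_ae (Eventually.of_forall fun h => ?_)
    exact Finset.sum_congr rfl fun t _ => by rw [G.gap_eq ho, inner_sub_left]

theorem regret_nonneg (n : ℕ) : 0 ≤ regret G π θ ξ n := by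
  rw [regret_eq]; exact integral_nonneg fun h => cumGap_nonneg G θ h

theorem ofReal_regret (n : ℕ) :
    ENNReal.ofReal (regret G π θ ξ n) =
      ∫⁻ h, ENNReal.ofReal (cumGap G θ h) ∂(histLaw G π θ ξ n) := by
  rw [regret_eq]
  exact ofReal_integral_eq_lintegral_ofReal
    (integrable_actions G π θ ξ (n := n) fun x => ∑ t, G.gap (x t) θ)
    (Eventually.of_forall fun h => cumGap_nonneg G θ h)

end Law

/-! ### Shifts of Gaussian measures -/

/-- The integral factors over coordinates into one-dimensional complex moment generating functions.
It gives the characteristic function of the tilted Gaussian. -/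
theorem integral_cexp_stdGaussian {m : ℕ} (δ t : Vec m) :
    ∫ x, Complex.exp ((⟪δ, x⟫_ℝ : ℝ) + (⟪x, t⟫_ℝ : ℝ) * Complex.I) ∂(stdGaussian (Vec m)) =
      Complex.exp ((‖δ‖ ^ 2 / 2 : ℝ) + (⟪δ, t⟫_ℝ : ℝ) * Complex.I - (‖t‖ ^ 2 / 2 : ℝ)) := by
  rw [← map_pi_eq_stdGaussian, integral_map (by fun_prop)
    (Continuous.aestronglyMeasurable (by fun_prop))]
  have h1 : ∀ x : Fin m → ℝ, Complex.exp ((⟪δ, WithLp.toLp 2 x⟫_ℝ : ℝ) +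
      (⟪WithLp.toLp 2 x, t⟫_ℝ : ℝ) * Complex.I) =
      ∏ i, Complex.exp ((δ i + t i * Complex.I) * x i) := by
    intro x
    rw [← Complex.exp_sum]
    congr 1
    simp only [PiLp.inner_apply, RCLike.inner_apply, conj_trivial, Complex.ofReal_sum,
      Complex.ofReal_mul, Finset.sum_mul, ← Finset.sum_add_distrib]
    exact Finset.sum_congr rfl fun i _ => by ring
  simp_rw [h1]
  rw [integral_fintype_prod_eq_prod
    (f := fun i (x : ℝ) => Complex.exp ((δ i + t i * Complex.I) * x))]
  have h2 : ∀ z : ℂ, ∫ x : ℝ, Complex.exp (z * x) ∂(gaussianReal 0 1) = Complex.exp (z ^ 2 / 2) :=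
    fun z => by simpa [complexMGF] using complexMGF_id_gaussianReal (μ := 0) (v := 1) z
  simp_rw [h2]
  rw [← Complex.exp_sum]
  congr 1
  simp only [EuclideanSpace.real_norm_sq_eq, PiLp.inner_apply, RCLike.inner_apply, conj_trivial,
    Complex.ofReal_sum, Complex.ofReal_mul, Finset.sum_mul, Complex.ofReal_div, Finset.sum_div,
    Complex.ofReal_pow, ← Finset.sum_add_distrib, ← Finset.sum_sub_distrib, Complex.ofReal_ofNat]
  refine Finset.sum_congr rfl fun i _ => ?_
  linear_combination (t i : ℂ) ^ 2 / 2 * Complex.I_sq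

theorem integrable_exp_inner_stdGaussian {m : ℕ} (δ : Vec m) :
    Integrable (fun x => Real.exp ⟪δ, x⟫_ℝ) (stdGaussian (Vec m)) := by
  have h : Integrable (fun x => Complex.exp ((⟪δ, x⟫_ℝ : ℝ) +
      (⟪x, (0 : Vec m)⟫_ℝ : ℝ) * Complex.I)) (stdGaussian (Vec m)) := by
    -- A non-integrable function has integral 0, but the formula gives an exponential.
    by_contra hn
    have := integral_cexp_stdGaussian δ 0
    rw [integral_undef hn] at this
    exact Complex.exp_ne_zero _ this.symm
  simpa [Complex.norm_exp] using h.norm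

/-- Both sides are finite measures with the same characteristic function. -/
theorem map_add_stdGaussian {m : ℕ} (δ : Vec m) :
    (stdGaussian (Vec m)).map (fun x => x + δ) = (stdGaussian (Vec m)).withDensity
      fun x => ENNReal.ofReal (Real.exp (⟪δ, x⟫_ℝ - ‖δ‖ ^ 2 / 2)) := by
  have hm : Measurable fun x : Vec m => Real.exp (⟪δ, x⟫_ℝ - ‖δ‖ ^ 2 / 2) := by fun_prop
  have hi : Integrable (fun x => Real.exp (⟪δ, x⟫_ℝ - ‖δ‖ ^ 2 / 2)) (stdGaussian (Vec m)) := by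
    simp_rw [Real.exp_sub]
    exact (integrable_exp_inner_stdGaussian δ).div_const _
  have := isFiniteMeasure_withDensity_ofReal hi.2
  refine Measure.ext_of_charFun (funext fun t => ?_)
  rw [charFun_map_add_const, charFun_stdGaussian, charFun_apply,
    integral_withDensity_eq_integral_toReal_smul hm.ennreal_ofReal (by simp)]
  have h1 : ∀ x : Vec m, (ENNReal.ofReal (Real.exp (⟪δ, x⟫_ℝ - ‖δ‖ ^ 2 / 2))).toReal •
      Complex.exp ((⟪x, t⟫_ℝ : ℝ) * Complex.I) = Complex.exp (-(‖δ‖ ^ 2 / 2 : ℝ)) *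
        Complex.exp ((⟪δ, x⟫_ℝ : ℝ) + (⟪x, t⟫_ℝ : ℝ) * Complex.I) := by
    intro x
    rw [ENNReal.toReal_ofReal (Real.exp_pos _).le, Complex.real_smul, Complex.ofReal_exp,
      ← Complex.exp_add, ← Complex.exp_add]
    congr 1
    push_cast
    ring
  simp_rw [h1]
  rw [integral_const_mul, integral_cexp_stdGaussian, ← Complex.exp_add, ← Complex.exp_add]
  congr 1
  push_cast
  ring

theorem lintegral_isoGaussian_add {m : ℕ} {ρ : ℝ} (hρ : ρ ≠ 0) (δ : Vec m) {F : Vec m → ℝ≥0∞}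
    (hF : Measurable F) : ∫⁻ e, F (e + δ) ∂(isoGaussian m ρ) =
      ∫⁻ e, F e * ENNReal.ofReal
        (Real.exp (⟪(ρ ^ 2)⁻¹ • δ, e⟫_ℝ - ρ ^ 2 / 2 * ‖(ρ ^ 2)⁻¹ • δ‖ ^ 2))
        ∂(isoGaussian m ρ) := by
  have hm : Measurable fun e : Vec m => ENNReal.ofReal
      (Real.exp (⟪(ρ ^ 2)⁻¹ • δ, e⟫_ℝ - ρ ^ 2 / 2 * ‖(ρ ^ 2)⁻¹ • δ‖ ^ 2)) := by fun_prop
  have hm2 : Measurable fun e : Vec m => F e * ENNReal.ofReal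
      (Real.exp (⟪(ρ ^ 2)⁻¹ • δ, e⟫_ℝ - ρ ^ 2 / 2 * ‖(ρ ^ 2)⁻¹ • δ‖ ^ 2)) := hF.mul hm
  rw [isoGaussian, lintegral_map (by fun_prop) (by fun_prop), lintegral_map hm2 (by fun_prop)]
  have h := map_add_stdGaussian (ρ⁻¹ • δ)
  have h1 : ∫⁻ e, F (ρ • (e + ρ⁻¹ • δ)) ∂(stdGaussian (Vec m)) =
      ∫⁻ e, F (ρ • e) ∂((stdGaussian (Vec m)).map (fun x => x + ρ⁻¹ • δ)) := by
    rw [lintegral_map (by fun_prop) (by fun_prop)]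
  have h2 : ∀ e : Vec m, ρ • (e + ρ⁻¹ • δ) = ρ • e + δ := fun e => by
    rw [smul_add, smul_inv_smul₀ hρ]
  simp_rw [h2] at h1
  rw [h1, h, lintegral_withDensity_eq_lintegral_mul _ (by fun_prop) (by fun_prop)]
  refine lintegral_congr fun e => ?_
  rw [Pi.mul_apply, mul_comm]
  congr 3
  simp only [inner_smul_left, inner_smul_right, norm_smul, mul_pow, norm_inv, norm_pow, inv_pow,
    Real.norm_eq_abs, sq_abs, conj_trivial]
  field_simp

/-! ### Change of measure and the two-point bound. -/

section LowerBound

set_option linter.unusedSectionVars false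

variable {A : Type*} [Finite A] [MeasurableSpace A] [MeasurableSingletonClass A] {d m : ℕ}
  (G : Game A d m) (π : Policy A m)

/-- Weights of the likelihood ratio of two parameters with difference `v`. -/
def ratioWeights (ρ : ℝ) (v : Vec d) (t : ℕ) (x : Hist A m t × A) : Vec m :=
  (ρ ^ 2)⁻¹ • G.M x.2 v

theorem measurable_ratioWeights (ρ : ℝ) (v : Vec d) (t : ℕ) :
    Measurable (ratioWeights G ρ v t) :=
  (measurable_of_finite fun a => (ρ ^ 2)⁻¹ • G.M a v).comp measurable_snd

/-- Change of measure between two parameters. -/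
theorem lintegral_histLaw_gaussian {ρ : ℝ} (hρ : ρ ≠ 0) (θ θ' : Vec d) (n : ℕ)
    {F : Hist A m n → ℝ≥0∞} (hF : Measurable F) :
    ∫⁻ h, F h ∂(histLaw G π θ' (gaussianNoise A m ρ) n) =
      ∫⁻ h, F h * ENNReal.ofReal (Real.exp (expo G θ (ratioWeights G ρ (θ' - θ)) ρ n h))
        ∂(histLaw G π θ (gaussianNoise A m ρ) n) := by
  induction n with
  | zero => simp [expo, histLaw]
  | succ n ih =>
    have hZ : ∀ n, Measurable fun h : Hist A m n =>
        ENNReal.ofReal (Real.exp (expo G θ (ratioWeights G ρ (θ' - θ)) ρ n h)) := fun n =>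
      (Real.measurable_exp.comp (measurable_expo G θ (measurable_ratioWeights G ρ _) ρ n)).ennreal_ofReal
    have hFZ : Measurable fun h => F h *
        ENNReal.ofReal (Real.exp (expo G θ (ratioWeights G ρ (θ' - θ)) ρ (n + 1) h)) :=
      hF.mul (hZ _)
    rw [lintegral_histLaw_succ G π θ' _ hF, ih, lintegral_histLaw_succ G π θ _ hFZ]
    swap
    · have h1 : Measurable fun p : (Hist A m n × A) × Vec m =>
          F (ext p.1.1 (p.1.2, G.M p.1.2 θ' + p.2)) := hF.comp (measurable_ext_obs G n)
      exact (h1.lintegral_kernel_prod_right' (κ := (gaussianNoise A m ρ).law n)).lintegral_kernel_prod_right'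
    refine lintegral_congr fun h => ?_
    rw [← lintegral_mul_const' _ _ ENNReal.ofReal_ne_top]
    refine lintegral_congr fun a => ?_
    rw [← lintegral_mul_const' _ _ ENNReal.ofReal_ne_top]
    have h1 : Measurable fun e : Vec m => F (ext h (a, G.M a θ + e)) :=
      (hF.comp (measurable_ext_obs G n)).comp (measurable_prodMk_left (x := (h, a)))
    have h2 := lintegral_isoGaussian_add hρ (G.M a (θ' - θ)) h1
    have h3 : ∀ e : Vec m, G.M a θ + (e + G.M a (θ' - θ)) = G.M a θ' + e := fun e => by
      rw [map_sub]; abel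
    simp_rw [h3] at h2
    change ∫⁻ e, _ ∂(isoGaussian m ρ) = ∫⁻ e, _ ∂(isoGaussian m ρ)
    rw [lintegral_mul_const' _ _ ENNReal.ofReal_ne_top, h2,
      ← lintegral_mul_const' _ _ ENNReal.ofReal_ne_top]
    refine lintegral_congr fun e => ?_
    rw [expo_ext, add_sub_cancel_left, Real.exp_add, ENNReal.ofReal_mul (Real.exp_pos _).le]
    rw [mul_assoc, mul_comm (ENNReal.ofReal _)]
    rfl

/-- The accumulated information of the actions played about the direction `v`. -/
def info (ρ : ℝ) (v : Vec d) {n : ℕ} (h : Hist A m n) : ℝ :=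
  ∑ t, ‖G.M (h t).1 v‖ ^ 2 / ρ ^ 2

theorem info_ext (ρ : ℝ) (v : Vec d) {t : ℕ} (h : Hist A m t) (p : A × Vec m) :
    info G ρ v (ext h p) = info G ρ v h + ‖G.M p.1 v‖ ^ 2 / ρ ^ 2 := by
  simp [info, Fin.sum_univ_castSucc, ext]

theorem measurable_info (ρ : ℝ) (v : Vec d) (n : ℕ) :
    Measurable (info (A := A) (m := m) G ρ v (n := n)) :=
  Finset.measurable_sum _ fun t _ =>
    (measurable_of_finite fun a => ‖G.M a v‖ ^ 2 / ρ ^ 2).comp (by fun_prop)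

/-- The noise terms cancel. So the likelihood ratio is bounded below wherever the opposite
exponential and the information are bounded above, and no relative entropy is needed. -/
theorem expo_add_expo_neg {ρ : ℝ} (hρ : ρ ≠ 0) (θ v : Vec d) (n : ℕ) (h : Hist A m n) :
    expo G θ (ratioWeights G ρ v) ρ n h +
      expo G θ (fun t x => -ratioWeights G ρ v t x) ρ n h = -info G ρ v h := by
  induction n with
  | zero => simp [expo, info]
  | succ n ih =>
    rw [← Fin.snoc_init_self (α := fun _ => A × Vec m) h]
    have := ih (Fin.init (α := fun _ => A × Vec m) h)
    change expo G θ _ ρ (n + 1) (ext _ _) + expo G θ _ ρ (n + 1) (ext _ _) = -info G ρ v (ext _ _)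
    rw [expo_ext, expo_ext, info_ext]
    simp only [inner_neg_left, norm_neg]
    have h2 : ρ ^ 2 * ‖ratioWeights G ρ v n (Fin.init (α := fun _ => A × Vec m) h,
        (h (Fin.last n)).1)‖ ^ 2 = ‖G.M (h (Fin.last n)).1 v‖ ^ 2 / ρ ^ 2 := by
      rw [ratioWeights, norm_smul, mul_pow, norm_inv, norm_pow, Real.norm_eq_abs, sq_abs]
      field_simp
    linarith

variable [Nonempty A]

/-- A two point lower bound. -/
theorem le_regret_add_regret {ρ : ℝ} (hρ : ρ ≠ 0) (hsub : (gaussianNoise A m ρ).IsSubGaussian ρ)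
    {θ θ' : Vec d} {n : ℕ} {κ : ℝ} (hκ : ∀ a, κ ≤ G.gap a θ + G.gap a θ')
    (hinfo : ∫⁻ h, ENNReal.ofReal (info G ρ (θ' - θ) h)
      ∂(histLaw G π θ (gaussianNoise A m ρ) n) ≤ 1 / 4) :
    n * κ * (Real.exp (-1) / 8) ≤ regret G π θ (gaussianNoise A m ρ) n +
      regret G π θ' (gaussianNoise A m ρ) n := by
  set W := ratioWeights G ρ (θ' - θ) with hW
  set P := histLaw G π θ (gaussianNoise A m ρ) n with hP
  have hWm := measurable_ratioWeights G (m := m) ρ (θ' - θ)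
  have hm1 : Measurable fun h => ENNReal.ofReal (Real.exp
      (expo G θ (fun t x => -W t x) ρ n h)) :=
    (Real.measurable_exp.comp (measurable_expo G θ (fun t => (hWm t).neg) ρ n)).ennreal_ofReal
  have hm2 : Measurable fun h : Hist A m n => ENNReal.ofReal (info G ρ (θ' - θ) h) :=
    (measurable_info G ρ _ n).ennreal_ofReal
  -- By Markov's inequality each bad event has probability at most 1/4. Off both, the likelihood
  -- ratio is at least exp(-1)/4; the remaining probability 1/2 turns this into the constant
  -- exp(-1)/8.
  set B₁ := {h : Hist A m n | 4 ≤ ENNReal.ofReal (Real.exp (expo G θ (fun t x => -W t x) ρ n h))}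
  set B₂ := {h : Hist A m n | 1 ≤ ENNReal.ofReal (info G ρ (θ' - θ) h)}
  have hB₁ : P B₁ ≤ 1 / 4 := by
    refine (meas_ge_le_lintegral_div hm1.aemeasurable (by norm_num) (by norm_num)).trans ?_
    exact ENNReal.div_le_div_right (lintegral_exp_expo_le G π θ hsub (fun t => (hWm t).neg) n) _
  have hB₂ : P B₂ ≤ 1 / 4 := by
    refine (meas_ge_le_lintegral_div hm2.aemeasurable (by norm_num) (by norm_num)).trans ?_
    simpa using hinfo
  have hBm : MeasurableSet (B₁ ∪ B₂) :=
    (measurableSet_le measurable_const hm1).union (measurableSet_le measurable_const hm2)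
  have hFm := hBm.compl
  have hF : 1 / 2 ≤ P (B₁ ∪ B₂)ᶜ := by
    rw [prob_compl_eq_one_sub hBm]
    have : P (B₁ ∪ B₂) ≤ 1 / 2 := by
      refine (measure_union_le _ _).trans ((add_le_add hB₁ hB₂).trans_eq ?_)
      rw [ENNReal.div_add_div_same, one_add_one_eq_two, show (4 : ℝ≥0∞) = 2 * 2 by norm_num,
        ENNReal.div_eq_div_iff (by simp) (by simp) (by simp) (by finiteness), mul_one]
    refine le_trans (le_of_eq ?_) (tsub_le_tsub_left this 1)
    simp [ENNReal.one_sub_inv_two]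
  have hZ : ∀ h ∈ (B₁ ∪ B₂)ᶜ, Real.exp (-1) / 4 ≤ Real.exp (expo G θ W ρ n h) := by
    intro h hh
    simp only [B₁, B₂, Set.mem_compl_iff, Set.mem_union, Set.mem_ofPred_eq, not_or, not_le] at hh
    obtain ⟨h1, h2⟩ := hh
    have h1' : Real.exp (expo G θ (fun t x => -W t x) ρ n h) < 4 := by
      rwa [show (4 : ℝ≥0∞) = ENNReal.ofReal 4 by simp,
        ENNReal.ofReal_lt_ofReal_iff (by norm_num)] at h1
    have h2' : info G ρ (θ' - θ) h < 1 := by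
      rwa [← ENNReal.ofReal_one, ENNReal.ofReal_lt_ofReal_iff (by norm_num)] at h2
    have h3 := expo_add_expo_neg G hρ θ (θ' - θ) n h
    rw [div_le_iff₀ (by norm_num)]
    calc Real.exp (-1) ≤ Real.exp (expo G θ W ρ n h + expo G θ (fun t x => -W t x) ρ n h) :=
          Real.exp_le_exp.2 (by rw [h3]; linarith)
      _ = Real.exp (expo G θ W ρ n h) * Real.exp (expo G θ (fun t x => -W t x) ρ n h) :=
          Real.exp_add _ _
      _ ≤ _ := by gcongr
  have hc : ∀ h : Hist A m n, n * κ ≤ cumGap G θ h + cumGap G θ' h := fun h => by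
    rw [cumGap, cumGap, ← Finset.sum_add_distrib]
    simpa using Finset.card_nsmul_le_sum Finset.univ _ κ fun t _ => hκ (h t).1
  have hexp : Real.exp (-1) / 4 ≤ 1 := by
    have : Real.exp (-1) ≤ 1 := Real.exp_le_one_iff.2 (by norm_num)
    linarith
  have r1 := regret_nonneg G π θ (gaussianNoise A m ρ) n
  have r2 := regret_nonneg G π θ' (gaussianNoise A m ρ) n
  rw [← ENNReal.ofReal_le_ofReal_iff (by positivity), ENNReal.ofReal_add r1 r2, ofReal_regret,
    ofReal_regret, lintegral_histLaw_gaussian G π hρ θ θ' n (measurable_cumGap G θ' n).ennreal_ofReal,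
    ← lintegral_add_left (measurable_cumGap G θ n).ennreal_ofReal]
  refine le_trans ?_ (setLIntegral_le_lintegral (B₁ ∪ B₂)ᶜ _)
  refine le_trans ?_ (setLIntegral_mono' (f := fun _ => ENNReal.ofReal (n * κ * (Real.exp (-1) / 4)))
    hFm fun h hh => ?_)
  · rw [setLIntegral_const]
    calc ENNReal.ofReal (n * κ * (Real.exp (-1) / 8))
        = ENNReal.ofReal (n * κ * (Real.exp (-1) / 4)) * (1 / 2) := by
          rw [show (1 / 2 : ℝ≥0∞) = ENNReal.ofReal (1 / 2) by
            rw [ENNReal.ofReal_div_of_pos (by norm_num)]; simp,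
            ← ENNReal.ofReal_mul' (by norm_num)]
          congr 1; ring
      _ ≤ _ := by gcongr
  · rw [← ENNReal.ofReal_mul (cumGap_nonneg G θ' h), ← ENNReal.ofReal_add (cumGap_nonneg G θ h)
      (mul_nonneg (cumGap_nonneg G θ' h) (Real.exp_pos _).le)]
    refine ENNReal.ofReal_le_ofReal ?_
    calc n * κ * (Real.exp (-1) / 4)
        ≤ (cumGap G θ h + cumGap G θ' h) * (Real.exp (-1) / 4) :=
          mul_le_mul_of_nonneg_right (hc h) (by positivity)
      _ = cumGap G θ h * (Real.exp (-1) / 4) + cumGap G θ' h * (Real.exp (-1) / 4) := by ring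
      _ ≤ _ := add_le_add (mul_le_of_le_one_right (cumGap_nonneg G θ h) hexp)
          (mul_le_mul_of_nonneg_left (hZ h hh) (cumGap_nonneg G θ' h))

end LowerBound

/-! ### Lower bounds for the three rates. -/

section LowerBound

set_option linter.unusedSectionVars false

variable {A : Type*} [Finite A] [Nonempty A] {d m : ℕ} (G : Game A d m)

theorem Game.IsKink.exists_le_gap_add_gap {G : Game A d m} {θ ν : Vec d} (h : G.IsKink θ ν) :
    ∃ κ s₀ : ℝ, 0 < κ ∧ 0 < s₀ ∧ ∀ s, 0 < s → s ≤ s₀ → θ + s • ν ∈ G.Θ ∧ θ - s • ν ∈ G.Θ ∧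
      ∀ c, κ * s ≤ G.gap c (θ + s • ν) + G.gap c (θ - s • ν) := by
  obtain ⟨hθ, hν, a, ha, b, hb, hlt⟩ := h
  rw [G.V_eq] at hν
  obtain ⟨s₁, hs₁, h₁⟩ := hθ.2 ν hν
  obtain ⟨s₂, hs₂, h₂⟩ := hθ.2 (-ν) (neg_mem hν)
  refine ⟨⟪G.φ b, ν⟫_ℝ - ⟪G.φ a, ν⟫_ℝ, min s₁ s₂, sub_pos.2 hlt, lt_min hs₁ hs₂,
    fun s hs hs' => ⟨h₁ s hs.le (hs'.trans (min_le_left _ _)), ?_, fun c => ?_⟩⟩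
  · simpa [sub_eq_add_neg] using h₂ s hs.le (hs'.trans (min_le_right _ _))
  -- Compare `c` with the steeper action on the positive side and with the flatter one on the
  -- negative side; the terms in `c` then cancel up to its gap at `θ`.
  · have e1 := G.inner_le_gap c b (θ + s • ν)
    have e2 := G.inner_le_gap c a (θ - s • ν)
    have e3 : ⟪G.φ a, θ⟫_ℝ = ⟪G.φ b, θ⟫_ℝ := le_antisymm (hb a) (ha b)
    have e4 := ha c
    simp only [inner_sub_left, inner_sub_right, inner_add_right, inner_smul_right] at e1 e2
    nlinarith

variable [MeasurableSpace A] [MeasurableSingletonClass A]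

/-- Either the regret at `θ + s • ν` already reaches `R`, or the information collected there is at
most 1/4 in expectation, since `hM` bounds it by a free part `u` per round and a part paid for by
regret. -/
theorem exists_le_regret {ρ : ℝ} (hρ : ρ ≠ 0) (hsub : (gaussianNoise A m ρ).IsSubGaussian ρ)
    {θ ν : Vec d} {s κ u v R : ℝ} {n : ℕ} (hu : 0 ≤ u) (hv : 0 ≤ v)
    (h₁ : θ + s • ν ∈ G.Θ) (h₂ : θ - s • ν ∈ G.Θ)
    (hκ : ∀ c, κ ≤ G.gap c (θ + s • ν) + G.gap c (θ - s • ν))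
    (hM : ∀ c, ‖G.M c ν‖ ^ 2 ≤ u + v * G.gap c (θ + s • ν))
    (hR : 4 * s ^ 2 / ρ ^ 2 * (n * u + v * R) ≤ 1 / 4) (π : Policy A m) :
    ∃ θ' ∈ G.Θ, min R (n * κ * (Real.exp (-1) / 16)) ≤ regret G π θ' (gaussianNoise A m ρ) n := by
  by_cases hreg : R ≤ regret G π (θ + s • ν) (gaussianNoise A m ρ) n
  · exact ⟨_, h₁, (min_le_left _ _).trans hreg⟩
  push Not at hreg
  have hle : ∀ h : Hist A m n, info G ρ (θ - s • ν - (θ + s • ν)) h ≤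
      4 * s ^ 2 / ρ ^ 2 * (n * u) + 4 * s ^ 2 / ρ ^ 2 * v * cumGap G (θ + s • ν) h := by
    intro h
    have hsum : ∑ t, ‖G.M (h t).1 ν‖ ^ 2 ≤ n * u + v * cumGap G (θ + s • ν) h := by
      refine (Finset.sum_le_sum fun t _ => hM (h t).1).trans_eq ?_
      simp [Finset.sum_add_distrib, cumGap, Finset.mul_sum]
    calc info G ρ (θ - s • ν - (θ + s • ν)) h
        = 4 * s ^ 2 / ρ ^ 2 * ∑ t, ‖G.M (h t).1 ν‖ ^ 2 := by
          rw [info, Finset.mul_sum]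
          refine Finset.sum_congr rfl fun t _ => ?_
          rw [show θ - s • ν - (θ + s • ν) = (-(2 * s)) • ν by module, map_smul, norm_smul,
            mul_pow, Real.norm_eq_abs, sq_abs]
          ring
      _ ≤ 4 * s ^ 2 / ρ ^ 2 * (n * u + v * cumGap G (θ + s • ν) h) := by gcongr
      _ = _ := by ring
  have hinfo : ∫⁻ h, ENNReal.ofReal (info G ρ (θ - s • ν - (θ + s • ν)) h)
      ∂(histLaw G π (θ + s • ν) (gaussianNoise A m ρ) n) ≤ 1 / 4 := by
    refine (lintegral_mono fun h => ENNReal.ofReal_le_ofReal (hle h)).trans ?_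
    have hr0 := regret_nonneg G π (θ + s • ν) (gaussianNoise A m ρ) n
    simp_rw [ENNReal.ofReal_add (show 0 ≤ 4 * s ^ 2 / ρ ^ 2 * (n * u) by positivity)
      (mul_nonneg (show 0 ≤ 4 * s ^ 2 / ρ ^ 2 * v by positivity) (cumGap_nonneg G _ _)),
      ENNReal.ofReal_mul (show 0 ≤ 4 * s ^ 2 / ρ ^ 2 * v by positivity)]
    rw [lintegral_add_left measurable_const, lintegral_const_mul' _ _ ENNReal.ofReal_ne_top,
      ← ofReal_regret, lintegral_const, measure_univ, mul_one,
      ← ENNReal.ofReal_mul (by positivity), ← ENNReal.ofReal_add (by positivity) (by positivity),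
      show (1 / 4 : ℝ≥0∞) = ENNReal.ofReal (1 / 4) by
        rw [ENNReal.ofReal_div_of_pos (by norm_num)]; simp]
    refine ENNReal.ofReal_le_ofReal (le_trans ?_ hR)
    calc _ = 4 * s ^ 2 / ρ ^ 2 * (n * u + v * regret G π (θ + s • ν) (gaussianNoise A m ρ) n) := by
          ring
      _ ≤ _ := by gcongr
  have h := le_regret_add_regret G π hρ hsub hκ hinfo
  by_contra! hno
  have e1 := (hno _ h₁).trans_le (min_le_right _ _)
  have e2 := (hno _ h₂).trans_le (min_le_right _ _)
  linarith

theorem le_minimaxRegret {ρ : ℝ} {𝒩 : Set (Noise A m)} (h_gauss : gaussianNoise A m ρ ∈ 𝒩) {n : ℕ}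
    {c : ℝ} (h : ∀ π, ∃ θ ∈ G.Θ, c ≤ regret G π θ (gaussianNoise A m ρ) n) :
    (c : EReal) ≤ minimaxRegret G 𝒩 n := by
  refine le_iInf fun π => ?_
  obtain ⟨θ, hθ, hc⟩ := h π
  exact le_iSup₂_of_le θ hθ (le_iSup₂_of_le _ h_gauss (EReal.coe_le_coe_iff.2 hc))

theorem isOmega_of_isHopeless {ρ : ℝ} (hρ : 0 < ρ) {𝒩 : Set (Noise A m)}
    (h_gauss : gaussianNoise A m ρ ∈ 𝒩) (h_sub : ∀ ξ ∈ 𝒩, ξ.IsSubGaussian ρ)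
    (hG : G.IsHopeless) :
    IsOmega (minimaxRegret G 𝒩) (fun n => (n : ℝ)) := by
  obtain ⟨θ, ν, hk, hM⟩ := G.exists_isKink_of_isHopeless hG
  obtain ⟨κ, s₀, hκ, hs₀, h⟩ := hk.exists_le_gap_add_gap
  obtain ⟨h₁, h₂, h₃⟩ := h s₀ hs₀ le_rfl
  refine ⟨κ * s₀ * (Real.exp (-1) / 16), by positivity, Eventually.of_forall fun n => ?_⟩
  refine le_minimaxRegret G h_gauss fun π => ?_
  have := exists_le_regret G hρ.ne' (h_sub _ h_gauss) (u := 0) (v := 0)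
    (R := κ * s₀ * (Real.exp (-1) / 16) * n) (n := n) le_rfl le_rfl h₁ h₂ h₃
    (by simp [hM]) (by simp) π
  rwa [show (n : ℝ) * (κ * s₀) * (Real.exp (-1) / 16) = κ * s₀ * (Real.exp (-1) / 16) * n by ring,
    min_self] at this

theorem isOmega_sqrt_of_not_isTrivial {ρ : ℝ} (hρ : 0 < ρ) {𝒩 : Set (Noise A m)}
    (h_gauss : gaussianNoise A m ρ ∈ 𝒩) (h_sub : ∀ ξ ∈ 𝒩, ξ.IsSubGaussian ρ)
    (hG : ¬ G.IsTrivial) :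
    IsOmega (minimaxRegret G 𝒩) (fun n => (n : ℝ) ^ (1 / 2 : ℝ)) := by
  cases nonempty_fintype A
  obtain ⟨θ, ν, hk⟩ := G.exists_isKink_of_not_isTrivial hG
  obtain ⟨κ, s₀, hκ, hs₀, h⟩ := hk.exists_le_gap_add_gap
  set u : ℝ := ∑ c, ‖G.M c ν‖ ^ 2 with hu
  have hu0 : 0 ≤ u := Finset.sum_nonneg fun _ _ => sq_nonneg _
  have hM : ∀ c, ‖G.M c ν‖ ^ 2 ≤ u := fun c =>
    Finset.single_le_sum (fun c _ => sq_nonneg ‖G.M c ν‖) (Finset.mem_univ c)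
  -- At separation `s₁ / √n` the total information is at most 4 s₁² u / ρ² ≤ 1/4.
  set s₁ := min s₀ (ρ / (4 * (u + 1))) with hs₁
  have hs₁0 : 0 < s₁ := lt_min hs₀ (by positivity)
  refine ⟨κ * s₁ * (Real.exp (-1) / 16), by positivity, eventually_atTop.2 ⟨1, fun n hn => ?_⟩⟩
  refine le_minimaxRegret G h_gauss fun π => ?_
  have hn1 : (1 : ℝ) ≤ n := by exact_mod_cast hn
  set y : ℝ := √n with hy
  have hy1 : 1 ≤ y := Real.one_le_sqrt.2 hn1
  have hyn : y ^ 2 = n := Real.sq_sqrt (by positivity)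
  beta_reduce
  rw [← Real.sqrt_eq_rpow, ← hy]
  obtain ⟨h₁, h₂, h₃⟩ := h (s₁ / y) (by positivity)
    ((div_le_self hs₁0.le hy1).trans (min_le_left _ _))
  have := exists_le_regret G hρ.ne' (h_sub _ h_gauss) (u := u) (v := 0)
    (R := κ * s₁ * (Real.exp (-1) / 16) * y) (n := n) hu0 le_rfl h₁ h₂ h₃
    (by simpa using hM) (by
      have e1 : s₁ * (4 * (u + 1)) ≤ ρ := (le_div_iff₀ (by positivity)).1 (min_le_right _ _)
      rw [← hyn]
      calc 4 * (s₁ / y) ^ 2 / ρ ^ 2 * (y ^ 2 * u + 0 * _) = 4 * s₁ ^ 2 * u / ρ ^ 2 := by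
            field_simp; ring
        _ ≤ 1 / 4 := by
          rw [div_le_iff₀ (by positivity)]
          have e2 : (s₁ * (4 * (u + 1))) ^ 2 ≤ ρ ^ 2 := by gcongr
          nlinarith [mul_nonneg (sq_nonneg s₁) hu0, mul_nonneg (sq_nonneg s₁) (sq_nonneg u)]) π
  rwa [show (n : ℝ) * (κ * (s₁ / y)) * (Real.exp (-1) / 16) = κ * s₁ * (Real.exp (-1) / 16) * y by
    rw [← hyn]; field_simp, min_self] at this

theorem isOmega_of_not_isLocallyObservable {ρ : ℝ} (hρ : 0 < ρ) {𝒩 : Set (Noise A m)}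
    (h_gauss : gaussianNoise A m ρ ∈ 𝒩) (h_sub : ∀ ξ ∈ 𝒩, ξ.IsSubGaussian ρ)
    (hG : ¬ G.IsLocallyObservable) :
    IsOmega (minimaxRegret G 𝒩) (fun n => (n : ℝ) ^ (2 / 3 : ℝ)) := by
  cases nonempty_fintype A
  obtain ⟨θ, ν, hk, hopt⟩ := G.exists_isKink_of_not_isLocallyObservable hG
  obtain ⟨κ, s₀, hκ, hs₀, h⟩ := hk.exists_le_gap_add_gap
  have hex : ∀ c, ∃ v : ℝ, 0 ≤ v ∧ ∀ᶠ s in nhds (0 : ℝ),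
      ‖G.M c ν‖ ^ 2 ≤ v * G.gap c (θ + s • ν) := by
    intro c
    by_cases hc : G.M c ν = 0
    · exact ⟨0, le_rfl, by simp [hc]⟩
    -- An informative action is suboptimal at `θ`, so by continuity its gap stays above half its
    -- value nearby.
    have hpos : 0 < G.gap c θ := lt_of_le_of_ne (G.gap_nonneg c θ) fun e =>
      hc (hopt c (G.gap_eq_zero_iff.1 e.symm))
    refine ⟨2 * ‖G.M c ν‖ ^ 2 / G.gap c θ, by positivity, ?_⟩
    have hcont : Continuous fun s : ℝ => G.gap c (θ + s • ν) :=
      (G.continuous_gap c).comp (by fun_prop)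
    have := (hcont.tendsto 0).eventually_const_lt (u := G.gap c θ / 2)
      (by simpa using half_lt_self hpos)
    filter_upwards [this] with s hs
    calc ‖G.M c ν‖ ^ 2 = 2 * ‖G.M c ν‖ ^ 2 / G.gap c θ * (G.gap c θ / 2) := by field_simp
      _ ≤ _ := by gcongr
  choose v hv0 hv using hex
  obtain ⟨ε, hε, hball⟩ := Metric.eventually_nhds_iff.1 (eventually_all.2 hv)
  set w : ℝ := ∑ c, v c with hw
  have hw0 : 0 ≤ w := Finset.sum_nonneg fun c _ => hv0 c
  set s₁ := min s₀ (ε / 2) with hs₁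
  have hs₁0 : 0 < s₁ := lt_min hs₀ (by positivity)
  -- With `s = s₁ / y` and `R = r * y ^ 2` the powers of `y` cancel in the information bound, which
  -- becomes w / (4(w + 1)).
  set r := ρ ^ 2 / (16 * s₁ ^ 2 * (w + 1)) with hr
  refine ⟨min r (κ * s₁ * (Real.exp (-1) / 16)), by positivity,
    eventually_atTop.2 ⟨1, fun n hn => ?_⟩⟩
  refine le_minimaxRegret G h_gauss fun π => ?_
  have hn1 : (1 : ℝ) ≤ n := by exact_mod_cast hn
  set y : ℝ := (n : ℝ) ^ (1 / 3 : ℝ) with hy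
  have hy1 : 1 ≤ y := Real.one_le_rpow hn1 (by norm_num)
  have hyn : y ^ 3 = n := by
    rw [hy, ← Real.rpow_natCast, ← Real.rpow_mul (by positivity)]; norm_num
  have hy2 : (n : ℝ) ^ (2 / 3 : ℝ) = y ^ 2 := by
    rw [hy, ← Real.rpow_natCast, ← Real.rpow_mul (by positivity)]; norm_num
  beta_reduce
  rw [hy2]
  have hle : s₁ / y ≤ s₁ := div_le_self hs₁0.le hy1
  obtain ⟨h₁, h₂, h₃⟩ := h (s₁ / y) (by positivity) (hle.trans (min_le_left _ _))
  obtain ⟨θ', hθ', hreg⟩ := exists_le_regret G hρ.ne' (h_sub _ h_gauss) (u := 0) (v := w)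
    (R := r * y ^ 2) (n := n) le_rfl hw0 h₁ h₂ h₃ (by
      intro c
      rw [zero_add]
      have h4 := hball (y := s₁ / y) (by
        rw [dist_zero_right, Real.norm_of_nonneg (by positivity)]
        have := hle.trans (min_le_right s₀ (ε / 2))
        linarith) c
      refine h4.trans (mul_le_mul_of_nonneg_right ?_ (G.gap_nonneg _ _))
      exact Finset.single_le_sum (fun c _ => hv0 c) (Finset.mem_univ c)) (by
      calc 4 * (s₁ / y) ^ 2 / ρ ^ 2 * (n * 0 + w * (r * y ^ 2))
          = (w / (w + 1)) * (1 / 4) := by rw [hr]; field_simp; ring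
        _ ≤ 1 * (1 / 4) := by
          gcongr; rw [div_le_one (by positivity)]; linarith
        _ = 1 / 4 := one_mul _) π
  refine ⟨θ', hθ', le_trans (le_of_eq ?_) hreg⟩
  rw [show (n : ℝ) * (κ * (s₁ / y)) * (Real.exp (-1) / 16) =
    κ * s₁ * (Real.exp (-1) / 16) * y ^ 2 by rw [← hyn]; field_simp,
    min_mul_of_nonneg _ _ (by positivity)]

end LowerBound

/-! ### Phased policies and their exponential potentials. -/

section Elimination

set_option linter.unusedSectionVars false

/-- The codes of the estimates of all pairs of actions obtained in the completed phases, the latest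
phase first. -/
def Code (A : Type*) : Type _ := List (A × A → ℤ)

instance (A : Type*) : MeasurableSpace (Code A) := ⊤

instance (A : Type*) : DiscreteMeasurableSpace (Code A) := ⟨fun _ => trivial⟩

/-- Rounding the estimates to integers makes the codes countable, so an arbitrary choice of a phase
for each code gives a measurable policy. -/
instance (A : Type*) [Finite A] : Countable (Code A) :=
  inferInstanceAs (Countable (List (A × A → ℤ)))

/-- Extension of a code by one phase. -/
def Code.cons {A : Type*} (z : A × A → ℤ) (σ : Code A) : Code A := List.cons z σ

/-- A phase of exploration: the number of rounds, the actions, and the weights of the observations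
in the estimates for all pairs of actions. -/
structure Phase (A : Type*) (m : ℕ) where
  length : ℕ
  act : ℕ → A
  weight : ℕ → A × A → Vec m

/-- The state of a phased policy: the code, the round within the phase, and the estimates. -/
abbrev State (A : Type*) : Type _ := (Code A × ℕ) × (A × A → ℝ)

variable {A : Type*} {d m : ℕ} (G : Game A d m) (ph : Code A → Phase A m) (δ : ℕ → ℝ)
  (θ₀ θ : Vec d)

/-- The action played in a state. -/
def State.act (st : State A) : A := (ph st.1.1).act st.1.2

/-- The state after an observation, before a new phase is started. -/
def State.pre (st : State A) (y : Vec m) : State A :=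
  ((st.1.1, st.1.2 + 1), fun p => st.2 p +
    ⟪(ph st.1.1).weight st.1.2 p, y - G.M ((ph st.1.1).act st.1.2) θ₀⟫_ℝ)

/-- The code after a phase has been completed. -/
def State.code (st : State A) : Code A :=
  Code.cons (fun p => ⌊st.2 p / δ st.1.1.length⌋) st.1.1

/-- Start of a new phase, if the present phase has been completed. -/
def State.post (st : State A) : State A :=
  open Classical in
  if st.1.2 = (ph st.1.1).length then ((st.code δ, 0), 0) else st

/-- The state of the phased policy after `t` rounds. -/
def state : (t : ℕ) → Hist A m t → State A
  | 0, _ => (([], 0), 0)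
  | t + 1, h => ((state t (Fin.init (α := fun _ => A × Vec m) h)).pre G ph θ₀
      (h (Fin.last t)).2).post ph δ

theorem state_ext {t : ℕ} (h : Hist A m t) (p : A × Vec m) :
    state G ph δ θ₀ (t + 1) (ext h p) = ((state G ph δ θ₀ t h).pre G ph θ₀ p.2).post ph δ := by
  simp [state, ext]

/-- The mean of the estimate for the pair `p` after `s` rounds of the phase with code `σ`. -/
def phaseMean (σ : Code A) (s : ℕ) (p : A × A) : ℝ :=
  ∑ j ∈ Finset.range s, ⟪(ph σ).weight j p, G.M ((ph σ).act j) (θ - θ₀)⟫_ℝ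

/-- The exponential potential of the estimation error for the pair `p`. -/
def potential (ρ : ℝ) (l : Code A → ℝ) (p : A × A) (st : State A) : ℝ :=
  Real.exp (l st.1.1 * (st.2 p - phaseMean G ph θ₀ θ st.1.1 st.1.2 p) -
    ρ ^ 2 / 2 * (l st.1.1 ^ 2 * ∑ j ∈ Finset.range st.1.2, ‖(ph st.1.1).weight j p‖ ^ 2))

theorem potential_pre (ρ : ℝ) (l : Code A → ℝ) (p : A × A) (st : State A) (e : Vec m) :
    potential G ph θ₀ θ ρ l p (st.pre G ph θ₀ (G.M (st.act ph) θ + e)) =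
      potential G ph θ₀ θ ρ l p st * Real.exp (⟪l st.1.1 • (ph st.1.1).weight st.1.2 p, e⟫_ℝ -
        ρ ^ 2 / 2 * ‖l st.1.1 • (ph st.1.1).weight st.1.2 p‖ ^ 2) := by
  rw [potential, potential, ← Real.exp_add]
  congr 1
  simp only [State.pre, State.act, phaseMean, Finset.sum_range_succ, map_sub, inner_sub_right,
    inner_add_right, inner_smul_left, norm_smul, mul_pow, Real.norm_eq_abs, sq_abs, conj_trivial]
  ring

/-- A new phase resets the potential to 1. -/
theorem potential_post_le (ρ : ℝ) (l : Code A → ℝ) (p : A × A) (st : State A) :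
    potential G ph θ₀ θ ρ l p (st.post ph δ) ≤ potential G ph θ₀ θ ρ l p st + 1 := by
  have h : 0 ≤ potential G ph θ₀ θ ρ l p st := (Real.exp_pos _).le
  unfold State.post
  split_ifs
  · simp [potential, phaseMean] at h ⊢
    exact h
  · linarith

/-- The sum of all potentials, for the scales `l` and `-l`, over all rounds. -/
def totalPotential [Fintype A] (ρ : ℝ) (l : Code A → ℝ) : (t : ℕ) → Hist A m t → ℝ
  | 0, _ => 0
  | t + 1, h =>
    let h' : Hist A m t := Fin.init (α := fun _ => A × Vec m) h
    let st := (state G ph δ θ₀ t h').pre G ph θ₀ (h (Fin.last t)).2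
    totalPotential ρ l t h' + ∑ p : A × A,
      (potential G ph θ₀ θ ρ l p st + potential G ph θ₀ θ ρ (-l) p st)

theorem totalPotential_ext [Fintype A] (ρ : ℝ) (l : Code A → ℝ) {t : ℕ} (h : Hist A m t) (q : A × Vec m) :
    totalPotential G ph δ θ₀ θ ρ l (t + 1) (ext h q) = totalPotential G ph δ θ₀ θ ρ l t h +
      ∑ p : A × A, (potential G ph θ₀ θ ρ l p ((state G ph δ θ₀ t h).pre G ph θ₀ q.2) +
        potential G ph θ₀ θ ρ (-l) p ((state G ph δ θ₀ t h).pre G ph θ₀ q.2)) := by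
  simp [totalPotential, ext]

section Measurability

variable [Finite A]

theorem measurable_state_act [MeasurableSpace A] : Measurable (State.act ph) := by
  refine measurable_from_prod_countable_right fun i => ?_
  change Measurable fun _ => (ph i.1).act i.2
  exact measurable_const

theorem measurable_pre :
    Measurable fun q : State A × Vec m => State.pre G ph θ₀ q.1 q.2 := by
  have h : Measurable fun q : (Code A × ℕ) × ((A × A → ℝ) × Vec m) =>
      State.pre G ph θ₀ (q.1, q.2.1) q.2.2 := by
    refine measurable_from_prod_countable_right fun i => ?_
    change Measurable fun q : (A × A → ℝ) × Vec m => (((i.1, i.2 + 1), fun p => q.1 p +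
      ⟪(ph i.1).weight i.2 p, q.2 - G.M ((ph i.1).act i.2) θ₀⟫_ℝ) : State A)
    fun_prop
  exact h.comp ((measurable_fst.comp measurable_fst).prodMk
    ((measurable_snd.comp measurable_fst).prodMk measurable_snd))

theorem measurable_post : Measurable (State.post ph δ) := by
  refine measurable_from_prod_countable_right fun i => ?_
  unfold State.post
  by_cases hi : i.2 = (ph i.1).length
  · simp only [hi, if_true]
    refine Measurable.prodMk (Measurable.prodMk ?_ measurable_const) measurable_const
    refine (measurable_of_countable fun z : A × A → ℤ => Code.cons z i.1).comp (measurable_pi_lambda _ fun p => ?_)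
    have h1 : Measurable fun y : A × A → ℝ => y p / δ i.1.length := by fun_prop
    exact h1.floor
  · simp only [hi, if_false]
    exact measurable_const.prodMk measurable_id

theorem measurable_potential (ρ : ℝ) (l : Code A → ℝ) (p : A × A) :
    Measurable (potential G ph θ₀ θ ρ l p) := by
  refine measurable_from_prod_countable_right fun i => ?_
  unfold potential
  dsimp only
  exact Real.measurable_exp.comp ((((measurable_pi_apply p).sub_const _).const_mul _).sub_const _)

variable [MeasurableSpace A] [MeasurableSingletonClass A]

theorem measurable_state (t : ℕ) : Measurable (state G ph δ θ₀ t) := by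
  induction t with
  | zero => exact measurable_const
  | succ t ih =>
    have h : Measurable fun h : Hist A m (t + 1) => (h (Fin.last t)).2 :=
      measurable_snd.comp (measurable_pi_apply _)
    exact (measurable_post ph δ).comp ((measurable_pre G ph θ₀).comp
      ((ih.comp (measurable_init t)).prodMk h))

/-- The policy that plays the phases `ph`. -/
def phasedPolicy : Policy A m where
  act t := Kernel.deterministic (fun h => (state G ph δ θ₀ t h).act ph)
    ((measurable_state_act ph).comp (measurable_state G ph δ θ₀ t))
  markov _ := inferInstance

variable (ξ : Noise A m)

theorem lintegral_phased_succ {t : ℕ} {F : Hist A m (t + 1) → ℝ≥0∞} (hF : Measurable F) :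
    ∫⁻ h, F h ∂(histLaw G (phasedPolicy G ph δ θ₀) θ ξ (t + 1)) =
      ∫⁻ h, ∫⁻ e, F (ext h ((state G ph δ θ₀ t h).act ph,
        G.M ((state G ph δ θ₀ t h).act ph) θ + e)) ∂(ξ.law t (h, (state G ph δ θ₀ t h).act ph))
        ∂(histLaw G (phasedPolicy G ph δ θ₀) θ ξ t) := by
  rw [lintegral_histLaw_succ _ _ _ _ hF]
  refine lintegral_congr fun h => ?_
  exact Kernel.lintegral_deterministic
    ((measurable_state_act ph).comp (measurable_state G ph δ θ₀ t))

theorem lintegral_potential_pre_le {ξ : Noise A m} {ρ : ℝ} (hξ : ξ.IsSubGaussian ρ)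
    (l : Code A → ℝ) (p : A × A) (t : ℕ) (x : Hist A m t × A) (st : State A) :
    ∫⁻ e, ENNReal.ofReal (potential G ph θ₀ θ ρ l p
      (st.pre G ph θ₀ (G.M (st.act ph) θ + e))) ∂(ξ.law t x) ≤
      ENNReal.ofReal (potential G ph θ₀ θ ρ l p st) := by
  simp_rw [potential_pre, ENNReal.ofReal_mul (show 0 ≤ potential G ph θ₀ θ ρ l p st from
    (Real.exp_pos _).le)]
  rw [lintegral_const_mul' _ _ ENNReal.ofReal_ne_top]
  exact mul_le_of_le_one_right' (hξ.lintegral_exp_le x _)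

/-- Within a phase the potential is a supermartingale, and a restart adds at most 1 per round. -/
theorem lintegral_potential_le {ξ : Noise A m} {ρ : ℝ} (hξ : ξ.IsSubGaussian ρ)
    (l : Code A → ℝ) (p : A × A) (t : ℕ) :
    ∫⁻ h, ENNReal.ofReal (potential G ph θ₀ θ ρ l p (state G ph δ θ₀ t h))
      ∂(histLaw G (phasedPolicy G ph δ θ₀) θ ξ t) ≤ t + 1 := by
  induction t with
  | zero => simp [state, potential, phaseMean]
  | succ t ih =>
    have hm : Measurable fun h : Hist A m (t + 1) =>
        ENNReal.ofReal (potential G ph θ₀ θ ρ l p (state G ph δ θ₀ (t + 1) h)) :=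
      ((measurable_potential G ph θ₀ θ ρ l p).comp (measurable_state G ph δ θ₀ _)).ennreal_ofReal
    rw [lintegral_phased_succ _ _ _ _ _ _ hm]
    simp_rw [state_ext]
    push_cast
    refine (lintegral_mono (g := fun h => ENNReal.ofReal (potential G ph θ₀ θ ρ l p
      (state G ph δ θ₀ t h)) + 1) fun h => ?_).trans ?_
    · refine (lintegral_mono fun e => (ENNReal.ofReal_le_ofReal
        (potential_post_le G ph δ θ₀ θ ρ l p _)).trans ENNReal.ofReal_add_le).trans ?_
      rw [lintegral_add_right _ measurable_const]
      refine add_le_add (lintegral_potential_pre_le G ph θ₀ θ hξ l p t _ _) ?_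
      simp
    · rw [lintegral_add_right _ measurable_const]
      simpa using add_le_add_left ih 1

variable [Fintype A]

theorem measurable_totalPotential (ρ : ℝ) (l : Code A → ℝ) (t : ℕ) :
    Measurable (totalPotential G ph δ θ₀ θ ρ l t) := by
  induction t with
  | zero => exact measurable_const
  | succ t ih =>
    have h : Measurable fun h : Hist A m (t + 1) => (h (Fin.last t)).2 :=
      measurable_snd.comp (measurable_pi_apply _)
    have h2 := (measurable_pre G ph θ₀).comp
      (((measurable_state G ph δ θ₀ t).comp (measurable_init t)).prodMk h)
    exact (ih.comp (measurable_init t)).add (Finset.measurable_sum _ fun p _ =>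
      ((measurable_potential G ph θ₀ θ ρ l p).comp h2).add
        ((measurable_potential G ph θ₀ θ ρ (-l) p).comp h2))

/-- Summing over rounds, pairs and signs replaces a union bound: one bound on the total controls
every estimate at once. -/
theorem lintegral_totalPotential_le {ξ : Noise A m} {ρ : ℝ} (hξ : ξ.IsSubGaussian ρ)
    (l : Code A → ℝ) (t : ℕ) :
    ∫⁻ h, ENNReal.ofReal (totalPotential G ph δ θ₀ θ ρ l t h)
      ∂(histLaw G (phasedPolicy G ph δ θ₀) θ ξ t) ≤ 2 * Fintype.card A ^ 2 * t ^ 2 := by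
  induction t with
  | zero => simp [totalPotential]
  | succ t ih =>
    rw [lintegral_phased_succ _ _ _ _ _ _
      (measurable_totalPotential G ph δ θ₀ θ ρ l (t + 1)).ennreal_ofReal]
    simp_rw [totalPotential_ext]
    set P := histLaw G (phasedPolicy G ph δ θ₀) θ ξ t
    have hpot : ∀ (l : Code A → ℝ) p, Measurable fun h =>
        ENNReal.ofReal (potential G ph θ₀ θ ρ l p (state G ph δ θ₀ t h)) := fun l p =>
      ((measurable_potential G ph θ₀ θ ρ l p).comp (measurable_state G ph δ θ₀ t)).ennreal_ofReal
    have hpre : ∀ (l : Code A → ℝ) p (st : State A), Measurable fun e : Vec m =>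
        ENNReal.ofReal (potential G ph θ₀ θ ρ l p (st.pre G ph θ₀ (G.M (st.act ph) θ + e))) :=
      fun l p st => ((measurable_potential G ph θ₀ θ ρ l p).comp ((measurable_pre G ph θ₀).comp
        (measurable_const.prodMk (measurable_const.add measurable_id)))).ennreal_ofReal
    have hpos : ∀ (l : Code A → ℝ) p (st : State A), 0 ≤ potential G ph θ₀ θ ρ l p st :=
      fun l p st => (Real.exp_pos _).le
    refine (lintegral_mono (g := fun h => ENNReal.ofReal (totalPotential G ph δ θ₀ θ ρ l t h) +
      ∑ p : A × A, (ENNReal.ofReal (potential G ph θ₀ θ ρ l p (state G ph δ θ₀ t h)) +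
        ENNReal.ofReal (potential G ph θ₀ θ ρ (-l) p (state G ph δ θ₀ t h)))) fun h => ?_).trans ?_
    · set st := state G ph δ θ₀ t h
      refine (lintegral_mono fun e => ENNReal.ofReal_add_le).trans ?_
      rw [lintegral_add_left measurable_const]
      refine add_le_add (by simp) ?_
      simp_rw [ENNReal.ofReal_sum_of_nonneg fun p (_ : p ∈ Finset.univ) =>
        add_nonneg (hpos l p _) (hpos (-l) p _), ENNReal.ofReal_add (hpos l _ _) (hpos (-l) _ _)]
      have hadd : ∀ p, Measurable fun e : Vec m =>
          ENNReal.ofReal (potential G ph θ₀ θ ρ l p (st.pre G ph θ₀ (G.M (st.act ph) θ + e))) +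
          ENNReal.ofReal (potential G ph θ₀ θ ρ (-l) p (st.pre G ph θ₀ (G.M (st.act ph) θ + e))) :=
        fun p => (hpre l p st).add (hpre (-l) p st)
      rw [lintegral_finsetSum _ fun p _ => hadd p]
      refine Finset.sum_le_sum fun p _ => ?_
      rw [lintegral_add_left (hpre l p st)]
      exact add_le_add (lintegral_potential_pre_le G ph θ₀ θ hξ l p t _ st)
        (lintegral_potential_pre_le G ph θ₀ θ hξ (-l) p t _ st)
    · have hadd : ∀ p, Measurable fun h =>
          ENNReal.ofReal (potential G ph θ₀ θ ρ l p (state G ph δ θ₀ t h)) +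
          ENNReal.ofReal (potential G ph θ₀ θ ρ (-l) p (state G ph δ θ₀ t h)) :=
        fun p => (hpot l p).add (hpot (-l) p)
      rw [lintegral_add_left (measurable_totalPotential G ph δ θ₀ θ ρ l t).ennreal_ofReal,
        lintegral_finsetSum _ fun p _ => hadd p]
      have h1 : ∀ p ∈ Finset.univ (α := A × A), ∫⁻ h,
          (ENNReal.ofReal (potential G ph θ₀ θ ρ l p (state G ph δ θ₀ t h)) +
          ENNReal.ofReal (potential G ph θ₀ θ ρ (-l) p (state G ph δ θ₀ t h))) ∂P ≤
          2 * (t + 1) := by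
        intro p _
        rw [lintegral_add_left (hpot l p), two_mul]
        exact add_le_add (lintegral_potential_le G ph δ θ₀ θ hξ l p t)
          (lintegral_potential_le G ph δ θ₀ θ hξ (-l) p t)
      refine (add_le_add ih (Finset.sum_le_card_nsmul _ _ _ h1)).trans ?_
      rw [Finset.card_univ, Fintype.card_prod, nsmul_eq_mul]
      norm_cast
      nlinarith [Nat.zero_le (Fintype.card A ^ 2 * t)]

end Measurability

end Elimination

/-! ### Regret of phased policies. -/

section PhasedRegret

set_option linter.unusedSectionVars false

variable {A : Type*} {d m : ℕ} (G : Game A d m) (ph : Code A → Phase A m) (δ : ℕ → ℝ)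
  (θ₀ θ : Vec d)

/-- The sum of the gaps of the actions that the phased policy chooses. -/
def policyGap : (t : ℕ) → Hist A m t → ℝ
  | 0, _ => 0
  | t + 1, h =>
    let h' : Hist A m t := Fin.init (α := fun _ => A × Vec m) h
    policyGap t h' + G.gap ((state G ph δ θ₀ t h').act ph) θ

theorem policyGap_ext {t : ℕ} (h : Hist A m t) (q : A × Vec m) :
    policyGap G ph δ θ₀ θ (t + 1) (ext h q) =
      policyGap G ph δ θ₀ θ t h + G.gap ((state G ph δ θ₀ t h).act ph) θ := by
  simp [policyGap, ext]

theorem exists_eq_ext {t : ℕ} (h : Hist A m (t + 1)) : ∃ h' q, h = ext (t := t) h' q :=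
  ⟨_, _, (Fin.snoc_init_self (α := fun _ => A × Vec m) h).symm⟩

variable [Fintype A] {ρ L B : ℝ} {n : ℕ} {good : Code A → Prop} {γ : Code A → ℝ}

/-- If the potentials of both signs are small at the end of a phase, then the estimate is
accurate. -/
theorem abs_sub_phaseMean_le {σ : Code A} {s : ℕ} {p : A × A} {acc : A × A → ℝ} {δ : ℝ}
    (hL : 0 < L) (hδ : 0 < δ) (l : Code A → ℝ) (hl : l σ = 2 * L / δ)
    (hvar : ρ ^ 2 * ∑ j ∈ Finset.range s, ‖(ph σ).weight j p‖ ^ 2 ≤ δ ^ 2 / (2 * L))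
    (h₁ : potential G ph θ₀ θ ρ l p ((σ, s), acc) < Real.exp L)
    (h₂ : potential G ph θ₀ θ ρ (-l) p ((σ, s), acc) < Real.exp L) :
    |acc p - phaseMean G ph θ₀ θ σ s p| ≤ δ := by
  simp only [potential, Real.exp_lt_exp, Pi.neg_apply, hl] at h₁ h₂
  set N := acc p - phaseMean G ph θ₀ θ σ s p
  set S := ∑ j ∈ Finset.range s, ‖(ph σ).weight j p‖ ^ 2
  -- The scale `2 * L / δ` makes the quadratic penalty at most `L`, so an exponent below `L` leaves
  -- at most `2 * L` for the linear part.
  have h3 : ρ ^ 2 / 2 * ((2 * L / δ) ^ 2 * S) ≤ L := by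
    calc ρ ^ 2 / 2 * ((2 * L / δ) ^ 2 * S) = (2 * L / δ) ^ 2 / 2 * (ρ ^ 2 * S) := by ring
      _ ≤ (2 * L / δ) ^ 2 / 2 * (δ ^ 2 / (2 * L)) := by gcongr
      _ = L := by field_simp
  rw [neg_sq] at h₂
  have h4 : 2 * L / δ * |N| ≤ 2 * L := by
    rcases abs_cases N with ⟨h, -⟩ | ⟨h, -⟩ <;> rw [h] <;> linarith
  rw [div_mul_eq_mul_div, div_le_iff₀ hδ] at h4
  exact le_of_mul_le_mul_left h4 (by positivity)

/-- On the event that the potentials are small, the phased policy stays in good states and has a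
small regret. -/
theorem phased_invariant (hL : 0 < L) (hδ : ∀ k, 0 < δ k) (h0 : good [])
    (hT : ∀ σ, 1 ≤ (ph σ).length)
    (hvar : ∀ σ p, ρ ^ 2 * ∑ j ∈ Finset.range (ph σ).length, ‖(ph σ).weight j p‖ ^ 2 ≤
      δ σ.length ^ 2 / (2 * L))
    (hgap : ∀ σ, good σ → ∀ j, G.gap ((ph σ).act j) θ ≤ γ σ)
    (hcost : ∀ σ, good σ → ∀ j ≤ (ph σ).length, j ≤ n → j * γ σ ≤ B)
    (hstep : ∀ σ, good σ → (ph σ).length ≤ n → ∀ z : A × A → ℤ,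
      (∀ p, |phaseMean G ph θ₀ θ σ (ph σ).length p - δ σ.length * z p| ≤ 2 * δ σ.length) →
      good (σ.cons z)) (t : ℕ) (ht : t ≤ n) (h : Hist A m t)
    (hΦ : totalPotential G ph δ θ₀ θ ρ (fun σ => 2 * L / δ σ.length) t h < Real.exp L) :
    good (state G ph δ θ₀ t h).1.1 ∧
      (state G ph δ θ₀ t h).1.2 < (ph (state G ph δ θ₀ t h).1.1).length ∧
      (state G ph δ θ₀ t h).1.2 ≤ t ∧
      policyGap G ph δ θ₀ θ t h ≤ (state G ph δ θ₀ t h).1.1.length * B +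
        (state G ph δ θ₀ t h).1.2 * γ (state G ph δ θ₀ t h).1.1 := by
  induction t with
  | zero => exact ⟨h0, hT _, le_rfl, by simp [policyGap, state]⟩
  | succ t ih =>
    obtain ⟨h, q, rfl⟩ := exists_eq_ext h
    set l : Code A → ℝ := fun σ => 2 * L / δ σ.length with hl
    have hpos : ∀ (l : Code A → ℝ) p (st : State A), 0 < potential G ph θ₀ θ ρ l p st :=
      fun l p st => Real.exp_pos _
    rw [totalPotential_ext] at hΦ
    set pre := (state G ph δ θ₀ t h).pre G ph θ₀ q.2 with hpre
    have htot0 : ∀ t (h : Hist A m t), 0 ≤ totalPotential G ph δ θ₀ θ ρ l t h := by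
      intro t
      induction t with
      | zero => exact fun _ => le_rfl
      | succ t ih =>
        exact fun h => add_nonneg (ih _) (Finset.sum_nonneg fun p _ =>
          (add_pos (hpos l p _) (hpos (-l) p _)).le)
    have hsum : ∀ p, potential G ph θ₀ θ ρ l p pre + potential G ph θ₀ θ ρ (-l) p pre ≤
        ∑ p, (potential G ph θ₀ θ ρ l p pre + potential G ph θ₀ θ ρ (-l) p pre) := fun p =>
      Finset.single_le_sum (f := fun p => potential G ph θ₀ θ ρ l p pre +
        potential G ph θ₀ θ ρ (-l) p pre)
        (fun p _ => (add_pos (hpos l p _) (hpos (-l) p _)).le) (Finset.mem_univ p)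
    obtain ⟨hg, hlt, hst, hreg⟩ := ih (by omega) h (lt_of_le_of_lt (le_add_of_nonneg_right
      (Finset.sum_nonneg fun p _ => (add_pos (hpos l p _) (hpos (-l) p _)).le)) hΦ)
    rw [state_ext, policyGap_ext]
    rw [← hpre]
    rcases hs : state G ph δ θ₀ t h with ⟨⟨σ, s⟩, acc⟩
    rw [hs] at hg hlt hst hreg hpre
    simp only at hg hlt hst hreg
    have hact : G.gap (State.act ph ((σ, s), acc)) θ ≤ γ σ := hgap σ hg s
    by_cases hend : s + 1 = (ph σ).length
    · have hpost : pre.post ph δ = ((pre.code δ, 0), 0) := if_pos (by rw [hpre]; exact hend)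
      have hcode : pre.code δ = Code.cons (fun p => ⌊pre.2 p / δ σ.length⌋) σ := by
        rw [hpre]; rfl
      rw [hpost, hcode]
      refine ⟨hstep σ hg (by omega) _ fun p => ?_, hT _, Nat.zero_le _, ?_⟩
      · have h1 : potential G ph θ₀ θ ρ l p pre < Real.exp L := by
          linarith [hsum p, hpos (-l) p pre, htot0 t h]
        have h2 : potential G ph θ₀ θ ρ (-l) p pre < Real.exp L := by
          linarith [hsum p, hpos l p pre, htot0 t h]
        have hpre' : pre = ((σ, (ph σ).length), pre.2) := by rw [← hend, hpre]; rfl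
        rw [hpre'] at h1 h2
        have h3 := abs_sub_phaseMean_le G ph θ₀ θ hL (hδ _) l rfl (hvar σ p) h1 h2
        have hδ' := hδ σ.length
        -- The error `2 * δ` consists of one `δ` from the noise and one from rounding.
        have h4 := Int.floor_le (pre.2 p / δ σ.length)
        have h5 := Int.lt_floor_add_one (pre.2 p / δ σ.length)
        rw [le_div_iff₀ hδ'] at h4
        rw [div_lt_iff₀ hδ'] at h5
        rw [abs_le] at h3 ⊢
        constructor <;> nlinarith
      · have h6 := hcost σ hg (s + 1) hend.le (by omega)
        have h7 : ((Code.cons (fun p => ⌊pre.2 p / δ σ.length⌋) σ).length : ℝ) =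
            σ.length + 1 := by exact_mod_cast List.length_cons
        simp only [Nat.cast_zero, zero_mul, add_zero, h7]
        push_cast at h6
        linarith
    · have hpost : pre.post ph δ = pre := if_neg (by rw [hpre]; exact hend)
      rw [hpost, hpre]
      refine ⟨hg, ?_, ?_, ?_⟩
      · change s + 1 < (ph σ).length
        omega
      · change s + 1 ≤ t + 1
        omega
      · change _ ≤ (σ.length : ℝ) * B + ((s + 1 : ℕ) : ℝ) * γ σ
        push_cast
        linarith

variable [MeasurableSpace A] [MeasurableSingletonClass A]

theorem measurable_policyGap (t : ℕ) : Measurable (policyGap G ph δ θ₀ θ t) := by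
  induction t with
  | zero => exact measurable_const
  | succ t ih =>
    exact (ih.comp (measurable_init t)).add ((measurable_of_finite fun a => G.gap a θ).comp
      ((measurable_state_act ph).comp ((measurable_state G ph δ θ₀ t).comp (measurable_init t))))

/-- The history space also contains actions that the deterministic policy would not choose; those
histories are null. -/
theorem lintegral_abs_cumGap_sub_policyGap (ξ : Noise A m) (t : ℕ) :
    ∫⁻ h, ENNReal.ofReal |cumGap G θ h - policyGap G ph δ θ₀ θ t h|
      ∂(histLaw G (phasedPolicy G ph δ θ₀) θ ξ t) = 0 := by
  induction t with
  | zero => simp [cumGap, policyGap]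
  | succ t ih =>
    have hm : Measurable fun h : Hist A m (t + 1) =>
        ENNReal.ofReal |cumGap G θ h - policyGap G ph δ θ₀ θ (t + 1) h| :=
      ((measurable_cumGap G θ _).sub (measurable_policyGap G ph δ θ₀ θ _)).abs.ennreal_ofReal
    rw [lintegral_phased_succ _ _ _ _ _ _ hm, ← ih]
    refine lintegral_congr fun h => ?_
    simp [cumGap_ext, policyGap_ext]

variable [Nonempty A]

/-- A regret bound for phased policies. -/
theorem regret_phasedPolicy_le {ξ : Noise A m} (hξ : ξ.IsSubGaussian ρ) {Γ : ℝ} {K : ℕ}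
    (hL : 0 < L) (hδ : ∀ k, 0 < δ k) (h0 : good [])
    (hT : ∀ σ, 1 ≤ (ph σ).length)
    (hvar : ∀ σ p, ρ ^ 2 * ∑ j ∈ Finset.range (ph σ).length, ‖(ph σ).weight j p‖ ^ 2 ≤
      δ σ.length ^ 2 / (2 * L))
    (hgap : ∀ σ, good σ → ∀ j, G.gap ((ph σ).act j) θ ≤ γ σ)
    (hcost : ∀ σ, good σ → ∀ j ≤ (ph σ).length, j ≤ n → j * γ σ ≤ B)
    (hstep : ∀ σ, good σ → (ph σ).length ≤ n → ∀ z : A × A → ℤ,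
      (∀ p, |phaseMean G ph θ₀ θ σ (ph σ).length p - δ σ.length * z p| ≤ 2 * δ σ.length) →
      good (σ.cons z))
    (hlen : ∀ σ, good σ → σ.length ≤ K) (hΓ : ∀ a, G.gap a θ ≤ Γ) :
    regret G (phasedPolicy G ph δ θ₀) θ ξ n ≤
      (K + 1) * B + n * Γ * Real.exp (-L) * (2 * Fintype.card A ^ 2 * n ^ 2) := by
  have hB : 0 ≤ B := by simpa using hcost [] h0 0 (Nat.zero_le _) (Nat.zero_le _)
  have hΓ0 : 0 ≤ Γ := (G.gap_nonneg (Classical.arbitrary A) θ).trans (hΓ _)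
  set l : Code A → ℝ := fun σ => 2 * L / δ σ.length with hl
  have hpol : ∀ t (h : Hist A m t), policyGap G ph δ θ₀ θ t h ≤ t * Γ := by
    intro t
    induction t with
    | zero => exact fun h => by simp [policyGap]
    | succ t ih =>
      intro h
      have h1 := ih (Fin.init (α := fun _ => A × Vec m) h)
      have h2 := hΓ ((state G ph δ θ₀ t (Fin.init (α := fun _ => A × Vec m) h)).act ph)
      simp only [policyGap]
      push_cast
      linarith
  have htot0 : ∀ t (h : Hist A m t), 0 ≤ totalPotential G ph δ θ₀ θ ρ l t h := by
    intro t
    induction t with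
    | zero => exact fun _ => le_rfl
    | succ t ih =>
      exact fun h => add_nonneg (ih _) (Finset.sum_nonneg fun p _ =>
        add_nonneg (Real.exp_pos _).le (Real.exp_pos _).le)
  -- When the potential reaches exp L, the trivial bound `n * Γ` is absorbed by the last term; this
  -- is Markov's inequality done pathwise.
  have hpath : ∀ h : Hist A m n, policyGap G ph δ θ₀ θ n h ≤
      (K + 1) * B + n * Γ * Real.exp (-L) * totalPotential G ph δ θ₀ θ ρ l n h := by
    intro h
    have ht := htot0 n h
    by_cases hΦ : totalPotential G ph δ θ₀ θ ρ l n h < Real.exp L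
    · obtain ⟨hg, hlt, hst, hreg⟩ := phased_invariant G ph δ θ₀ θ hL hδ h0 hT hvar hgap hcost
        hstep n le_rfl h hΦ
      have h1 := hcost _ hg _ hlt.le hst
      have h2 : ((state G ph δ θ₀ n h).1.1.length : ℝ) * B ≤ K * B := by
        gcongr; exact hlen _ hg
      have h3 : 0 ≤ n * Γ * Real.exp (-L) * totalPotential G ph δ θ₀ θ ρ l n h := by positivity
      linarith
    · push Not at hΦ
      have h1 := hpol n h
      have h2 : (1 : ℝ) ≤ Real.exp (-L) * totalPotential G ph δ θ₀ θ ρ l n h := by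
        calc (1 : ℝ) = Real.exp (-L) * Real.exp L := by rw [← Real.exp_add]; simp
          _ ≤ _ := by gcongr
      have h3 : n * Γ * 1 ≤ n * Γ * (Real.exp (-L) * totalPotential G ph δ θ₀ θ ρ l n h) := by
        gcongr
      have h4 : 0 ≤ (K + 1) * B := by positivity
      linarith
  have hfin : ∀ h : Hist A m n, ENNReal.ofReal (cumGap G θ h) ≤
      ENNReal.ofReal |cumGap G θ h - policyGap G ph δ θ₀ θ n h| +
      (ENNReal.ofReal ((K + 1) * B) + ENNReal.ofReal (n * Γ * Real.exp (-L)) *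
        ENNReal.ofReal (totalPotential G ph δ θ₀ θ ρ l n h)) := by
    intro h
    rw [← ENNReal.ofReal_mul (by positivity), ← ENNReal.ofReal_add (by positivity)
      (mul_nonneg (by positivity) (htot0 n h)), ← ENNReal.ofReal_add (abs_nonneg _)
      (add_nonneg (by positivity) (mul_nonneg (by positivity) (htot0 n h)))]
    refine ENNReal.ofReal_le_ofReal ?_
    linarith [hpath h, le_abs_self (cumGap G θ h - policyGap G ph δ θ₀ θ n h)]
  rw [← ENNReal.ofReal_le_ofReal_iff (by positivity), ofReal_regret]
  refine (lintegral_mono hfin).trans ?_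
  have hm1 : Measurable fun h : Hist A m n =>
      ENNReal.ofReal |cumGap G θ h - policyGap G ph δ θ₀ θ n h| :=
    ((measurable_cumGap G θ _).sub (measurable_policyGap G ph δ θ₀ θ _)).abs.ennreal_ofReal
  rw [lintegral_add_left hm1, lintegral_abs_cumGap_sub_policyGap, zero_add,
    lintegral_add_left measurable_const, lintegral_const_mul' _ _ ENNReal.ofReal_ne_top,
    lintegral_const, measure_univ, mul_one, ENNReal.ofReal_add (by positivity) (by positivity),
    ENNReal.ofReal_mul (p := n * Γ * Real.exp (-L)) (by positivity)]
  gcongr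
  refine (lintegral_totalPotential_le G ph δ θ₀ θ hξ l n).trans (le_of_eq ?_)
  rw [ENNReal.ofReal_mul (by positivity), ENNReal.ofReal_mul (by positivity),
    ENNReal.ofReal_pow (by positivity), ENNReal.ofReal_pow (by positivity)]
  simp

end PhasedRegret

/-! ### Exploration phases and elimination of parameters. -/

section UpperBound

set_option linter.unusedSectionVars false

theorem exists_cyclic_enumeration (A : Type*) [Fintype A] [Nonempty A] :
    ∃ idx : ℕ → A, ∀ (R : ℕ) (f : A → ℝ),
      ∑ j ∈ Finset.range (R * Fintype.card A), f (idx j) = R * ∑ a, f a := by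
  have hN : 0 < Fintype.card A := Fintype.card_pos
  let e := (Fintype.equivFin A).symm
  refine ⟨fun j => e ⟨j % Fintype.card A, Nat.mod_lt _ hN⟩, fun R f => ?_⟩
  induction R with
  | zero => simp
  | succ R ih =>
    rw [Nat.succ_mul, Finset.sum_range_add, ih]
    have : ∑ j ∈ Finset.range (Fintype.card A),
        f (e ⟨(R * Fintype.card A + j) % Fintype.card A, Nat.mod_lt _ hN⟩) = ∑ a, f a := by
      rw [← e.sum_comp, Finset.sum_range]
      refine Finset.sum_congr rfl fun i _ => ?_
      congr 2
      ext
      simp [Nat.mod_eq_of_lt i.2]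
    rw [this]
    push_cast
    ring

variable {A : Type*} [Fintype A] [Nonempty A] {d m : ℕ} (G : Game A d m)

/-- A phase that plays actions of `S` only, and estimates the differences of the rewards of the
actions in `Q` with small variance. -/
theorem exists_phase {S : Finset A} (hS : S.Nonempty) (Q : Set A) {x δ L ρ : ℝ} (hx : 0 ≤ x)
    (hδ : 0 < δ) (hL : 0 < L)
    (h : ∀ a ∈ Q, ∀ b ∈ Q, ∀ ν ∈ G.V, ⟪G.φ a - G.φ b, ν⟫_ℝ ^ 2 ≤ x * ∑ c ∈ S, ‖G.M c ν‖ ^ 2) :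
    ∃ ph : Phase A m, 1 ≤ ph.length ∧
      (ph.length : ℝ) ≤ Fintype.card A * (2 * ρ ^ 2 * L * x / δ ^ 2 + 2) ∧
      (∀ j, ph.act j ∈ S) ∧
      (∀ p, ρ ^ 2 * ∑ j ∈ Finset.range ph.length, ‖ph.weight j p‖ ^ 2 ≤ δ ^ 2 / (2 * L)) ∧
      ∀ a ∈ Q, ∀ b ∈ Q, ∀ ν ∈ G.V, ∑ j ∈ Finset.range ph.length,
        ⟪ph.weight j (a, b), G.M (ph.act j) ν⟫_ℝ = ⟪G.φ a - G.φ b, ν⟫_ℝ := by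
  classical
  obtain ⟨idx, hidx⟩ := exists_cyclic_enumeration A
  obtain ⟨s₀, hs₀⟩ := hS
  have hw : ∀ p : A × A, ∃ w : A → Vec m, (p.1 ∈ Q → p.2 ∈ Q → ∀ ν ∈ G.V,
      ∑ c ∈ S, ⟪w c, G.M c ν⟫_ℝ = ⟪G.φ p.1 - G.φ p.2, ν⟫_ℝ) ∧ ∑ c ∈ S, ‖w c‖ ^ 2 ≤ x := by
    intro p
    by_cases hp : p.1 ∈ Q ∧ p.2 ∈ Q
    · obtain ⟨w, h1, h2⟩ := G.exists_weights S _ hx (h _ hp.1 _ hp.2)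
      exact ⟨w, fun _ _ => h1, h2⟩
    · exact ⟨0, fun h1 h2 => (hp ⟨h1, h2⟩).elim, by simpa using hx⟩
  choose w hw1 hw2 using hw
  -- `R` repetitions with weights scaled by 1/R give variance proxy at most ρ² x / R; the extra 1
  -- keeps the phase nonempty when `x = 0`.
  set R : ℕ := ⌈2 * ρ ^ 2 * L * x / δ ^ 2⌉₊ + 1 with hR
  have hR0 : (0 : ℝ) < R := by positivity
  have hR1 : 2 * ρ ^ 2 * L * x / δ ^ 2 ≤ R := by
    rw [hR]; push_cast; linarith [Nat.le_ceil (2 * ρ ^ 2 * L * x / δ ^ 2)]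
  have hR2 : (R : ℝ) ≤ 2 * ρ ^ 2 * L * x / δ ^ 2 + 2 := by
    rw [hR]; push_cast
    linarith [Nat.ceil_lt_add_one (show 0 ≤ 2 * ρ ^ 2 * L * x / δ ^ 2 by positivity)]
  have hsumS : ∀ f : A → ℝ, ∑ a, (if a ∈ S then f a else 0) = ∑ a ∈ S, f a := fun f => by
    rw [← Finset.sum_filter]; simp
  -- Turns of actions outside `S` are filled with `s₀` at weight zero.
  refine ⟨⟨R * Fintype.card A, fun j => if idx j ∈ S then idx j else s₀,
    fun j p => if idx j ∈ S then (R : ℝ)⁻¹ • w p (idx j) else 0⟩, ?_, ?_, fun j => ?_,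
    fun p => ?_, fun a ha b hb ν hν => ?_⟩
  · exact Nat.mul_pos (Nat.succ_pos _) Fintype.card_pos
  · push_cast
    rw [mul_comm]
    gcongr
  · dsimp only
    split_ifs with hj
    exacts [hj, hs₀]
  · have h1 : ∀ j, ‖(if idx j ∈ S then (R : ℝ)⁻¹ • w p (idx j) else 0)‖ ^ 2 =
        (fun a => if a ∈ S then (R : ℝ)⁻¹ ^ 2 * ‖w p a‖ ^ 2 else 0) (idx j) := fun j => by
      dsimp only
      split_ifs
      · rw [norm_smul, mul_pow, Real.norm_of_nonneg (by positivity)]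
      · simp
    dsimp only
    rw [(Finset.sum_congr rfl fun j _ => h1 j).trans (hidx R fun a => if a ∈ S then (R : ℝ)⁻¹ ^ 2 * ‖w p a‖ ^ 2 else 0),
      hsumS, ← Finset.mul_sum]
    calc ρ ^ 2 * (R * ((R : ℝ)⁻¹ ^ 2 * ∑ c ∈ S, ‖w p c‖ ^ 2))
        ≤ ρ ^ 2 * (R * ((R : ℝ)⁻¹ ^ 2 * x)) := by gcongr; exact hw2 p
      _ = ρ ^ 2 * x / R := by field_simp
      _ ≤ δ ^ 2 / (2 * L) := by
        rw [div_le_div_iff₀ hR0 (by positivity)]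
        rw [div_le_iff₀ (by positivity)] at hR1
        linarith
  · have h1 : ∀ j, ⟪(if idx j ∈ S then (R : ℝ)⁻¹ • w (a, b) (idx j) else 0),
        G.M (if idx j ∈ S then idx j else s₀) ν⟫_ℝ =
        (fun c => if c ∈ S then (R : ℝ)⁻¹ * ⟪w (a, b) c, G.M c ν⟫_ℝ else 0) (idx j) := fun j => by
      dsimp only
      split_ifs
      · rw [inner_smul_left]; simp
      · simp
    dsimp only
    rw [(Finset.sum_congr rfl fun j _ => h1 j).trans (hidx R fun c => if c ∈ S then (R : ℝ)⁻¹ * ⟪w (a, b) c, G.M c ν⟫_ℝ else 0),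
      hsumS, ← Finset.mul_sum, hw1 (a, b) ha hb ν hν, ← mul_assoc,
      mul_inv_cancel₀ hR0.ne', one_mul]

/-- The parameters that are compatible with a code. -/
def region (δ : ℕ → ℝ) (θ₀ : Vec d) : List (A × A → ℤ) → Set (Vec d)
  | [] => G.Θ
  | z :: σ => {θ | θ ∈ region δ θ₀ σ ∧ ∀ a ∈ G.plausible (region δ θ₀ σ),
      ∀ b ∈ G.plausible (region δ θ₀ σ),
        |⟪G.φ a - G.φ b, θ - θ₀⟫_ℝ - δ σ.length * z (a, b)| ≤ 2 * δ σ.length}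

theorem region_subset (δ : ℕ → ℝ) (θ₀ : Vec d) (σ : List (A × A → ℤ)) :
    region G δ θ₀ σ ⊆ G.Θ := by
  induction σ with
  | nil => exact subset_rfl
  | cons z σ ih => exact fun θ hθ => ih hθ.1

/-- Two parameters of a region assign reward differences within 4δ of each other, which is the next
ε. Where `b` is optimal, its difference to any action has the favourable sign. -/
theorem gap_le_of_mem_region {ε : ℕ → ℝ} (hε : ∀ b, ∀ θ ∈ G.Θ, G.gap b θ ≤ ε 0) (θ₀ : Vec d)
    (σ : List (A × A → ℤ)) {b : A} (hb : b ∈ G.plausible (region G (fun k => ε (k + 1) / 4) θ₀ σ))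
    {θ : Vec d} (hθ : θ ∈ region G (fun k => ε (k + 1) / 4) θ₀ σ) : G.gap b θ ≤ ε σ.length := by
  cases σ with
  | nil => exact hε b θ hθ
  | cons z σ =>
    obtain ⟨a, ha, hao⟩ := G.exists_pareto_optimal (region_subset G _ _ _ hθ)
    obtain ⟨hbp, θ', hθ', hb0⟩ := hb
    have ha' : a ∈ G.plausible (region G (fun k => ε (k + 1) / 4) θ₀ σ) :=
      ⟨ha, θ, hθ.1, G.gap_eq_zero_iff.2 hao⟩
    have hb' : b ∈ G.plausible (region G (fun k => ε (k + 1) / 4) θ₀ σ) :=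
      ⟨hbp, θ', hθ'.1, hb0⟩
    have h1 := abs_le.1 (hθ.2 a ha' b hb')
    have h2 := abs_le.1 (hθ'.2 a ha' b hb')
    have h3 := G.gap_eq_zero_iff.1 hb0 a
    rw [G.gap_eq hao]
    simp only [inner_sub_left, inner_sub_right] at h1 h2
    simp only [List.length_cons]
    linarith [h1.1, h1.2, h2.1, h2.2]

variable [MeasurableSpace A] [MeasurableSingletonClass A]

/-- An upper bound for the minimax regret from exploration phases. -/
theorem minimaxRegret_le {ρ : ℝ} {𝒩 : Set (Noise A m)} (h_sub : ∀ ξ ∈ 𝒩, ξ.IsSubGaussian ρ)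
    {K n : ℕ} {ε : ℕ → ℝ} {L B : ℝ} (hL : 0 < L) (hε : ∀ k, 0 < ε k)
    (hε0 : ∀ b, ∀ θ ∈ G.Θ, G.gap b θ ≤ ε 0) (hlast : n * ε K ≤ B)
    (hdesign : ∀ k < K, ∀ E ⊆ G.Θ, E.Nonempty → (∀ b ∈ G.plausible E, ∀ θ ∈ E, G.gap b θ ≤ ε k) →
      ∃ S : Finset A, S.Nonempty ∧ ∃ x γ : ℝ, 0 ≤ x ∧ 0 ≤ γ ∧ (∀ c ∈ S, ∀ θ ∈ E, G.gap c θ ≤ γ) ∧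
        (∀ a ∈ G.plausible E, ∀ b ∈ G.plausible E, ∀ ν ∈ G.V,
          ⟪G.φ a - G.φ b, ν⟫_ℝ ^ 2 ≤ x * ∑ c ∈ S, ‖G.M c ν‖ ^ 2) ∧
        ∀ s : ℝ, 0 ≤ s → s ≤ n →
          s ≤ Fintype.card A * (2 * ρ ^ 2 * L * x / (ε (k + 1) / 4) ^ 2 + 2) → s * γ ≤ B) :
    minimaxRegret G 𝒩 n ≤ (((K + 1) * B +
      n * ε 0 * Real.exp (-L) * (2 * Fintype.card A ^ 2 * n ^ 2) : ℝ) : EReal) := by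
  obtain ⟨θ₀, hθ₀⟩ := G.nonempty_Θ
  set δ : ℕ → ℝ := fun k => ε (k + 1) / 4 with hδdef
  have hδ : ∀ k, 0 < δ k := fun k => div_pos (hε _) (by norm_num)
  have hex : ∀ σ : Code A, ∃ (ph : Phase A m) (γ : ℝ), 1 ≤ ph.length ∧
      (∀ p, ρ ^ 2 * ∑ j ∈ Finset.range ph.length, ‖ph.weight j p‖ ^ 2 ≤
        δ σ.length ^ 2 / (2 * L)) ∧
      ((region G δ θ₀ σ).Nonempty → σ.length ≤ K →
        (∀ θ ∈ region G δ θ₀ σ, ∀ j, G.gap (ph.act j) θ ≤ γ) ∧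
        (∀ j ≤ ph.length, j ≤ n → j * γ ≤ B) ∧
        (ph.length ≤ n → σ.length < K ∧ ∀ a ∈ G.plausible (region G δ θ₀ σ),
          ∀ b ∈ G.plausible (region G δ θ₀ σ), ∀ ν ∈ G.V, ∑ j ∈ Finset.range ph.length,
            ⟪ph.weight j (a, b), G.M (ph.act j) ν⟫_ℝ = ⟪G.φ a - G.φ b, ν⟫_ℝ)) := by
    intro σ
    have hvar0 : 0 ≤ δ σ.length ^ 2 / (2 * L) := by positivity
    by_cases hne : (region G δ θ₀ σ).Nonempty
    swap
    · exact ⟨⟨1, fun _ => Classical.arbitrary A, fun _ _ => 0⟩, 0, le_rfl,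
        by simpa using hvar0, fun h => (hne h).elim⟩
    rcases lt_or_ge σ.length K with hK | hK
    · obtain ⟨S, hS, x, γ, hx, hγ, hgap, hinfo, hcost⟩ := hdesign _ hK _ (region_subset G δ θ₀ σ)
        hne fun b hb θ hθ => gap_le_of_mem_region G hε0 θ₀ σ hb hθ
      obtain ⟨ph, h1, h2, h3, h4, h5⟩ := exists_phase G (ρ := ρ) hS _ hx (hδ σ.length) hL hinfo
      refine ⟨ph, γ, h1, h4, fun _ _ => ⟨fun θ hθ j => hgap _ (h3 j) θ hθ, fun j hj hjn => ?_,
        fun _ => ⟨hK, h5⟩⟩⟩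
      exact hcost j (Nat.cast_nonneg _) (by exact_mod_cast hjn)
        (le_trans (by exact_mod_cast hj) h2)
    · obtain ⟨θ, hθ⟩ := hne
      obtain ⟨a, ha, hao⟩ := G.exists_pareto_optimal (region_subset G _ _ _ hθ)
      have ha' : a ∈ G.plausible (region G δ θ₀ σ) := ⟨ha, θ, hθ, G.gap_eq_zero_iff.2 hao⟩
      -- After `K` phases the policy commits to one plausible action; length `n + 1` means that this
      -- phase never ends within the horizon.
      refine ⟨⟨n + 1, fun _ => a, fun _ _ => 0⟩, ε σ.length, Nat.le_add_left _ _,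
        by simpa using hvar0, fun _ hK' => ⟨fun θ hθ _ => gap_le_of_mem_region G hε0 θ₀ σ ha' hθ,
          fun j _ hjn => ?_, fun h => absurd h (by simp)⟩⟩
      rw [le_antisymm hK' hK]
      refine le_trans (mul_le_mul_of_nonneg_right ?_ (hε K).le) hlast
      exact_mod_cast hjn
  choose ph γ hT hvar hgood using hex
  refine (iInf_le _ (phasedPolicy G ph δ θ₀)).trans ?_
  refine iSup₂_le fun θ hθ => iSup₂_le fun ξ hξ => EReal.coe_le_coe_iff.2 ?_
  refine regret_phasedPolicy_le G ph δ θ₀ θ (h_sub ξ hξ)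
    (good := fun σ => θ ∈ region G δ θ₀ σ ∧ σ.length ≤ K) (γ := γ) hL hδ ⟨hθ, Nat.zero_le _⟩ hT
    hvar (fun σ h j => (hgood σ ⟨θ, h.1⟩ h.2).1 θ h.1 j)
    (fun σ h => (hgood σ ⟨θ, h.1⟩ h.2).2.1) (fun σ h hn z hz => ?_) (fun σ h => h.2)
    (fun a => hε0 a θ hθ)
  obtain ⟨hK, hest⟩ := (hgood σ ⟨θ, h.1⟩ h.2).2.2 hn
  refine ⟨⟨h.1, fun a ha b hb => ?_⟩, hK⟩
  rw [← hest a ha b hb _ (G.sub_mem_V hθ hθ₀)]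
  exact hz (a, b)

end UpperBound

/-! ### Upper bounds for the rates. -/

section Rates

set_option linter.unusedSectionVars false

theorem isThetaTilde_of_isOmega {f : ℕ → EReal} {g : ℕ → ℝ} (hg : ∀ n, 0 ≤ g n)
    (h : IsOmega f g) {k : ℕ} {C : ℝ} (hC : 0 < C)
    (h' : ∀ᶠ n : ℕ in atTop, f n ≤ ((C * g n * Real.log n ^ k : ℝ) : EReal)) :
    IsThetaTilde f g := by
  obtain ⟨c, hc, hcf⟩ := h
  refine ⟨k, c, C, hc, hC, ?_⟩
  have hlog : ∀ᶠ n : ℕ in atTop, 1 ≤ Real.log n :=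
    (Real.tendsto_log_atTop.comp tendsto_natCast_atTop_atTop).eventually_ge_atTop 1
  filter_upwards [hcf, h', hlog] with n h1 h2 h3
  refine ⟨le_trans (EReal.coe_le_coe_iff.2 ?_) h1, h2⟩
  exact div_le_self (mul_nonneg hc.le (hg n)) (one_le_pow₀ h3)

variable {A : Type*} [Fintype A] [Nonempty A] {d m : ℕ} (G : Game A d m)

theorem exists_gap_le : ∃ Γ : ℝ, 0 < Γ ∧ ∀ b, ∀ θ ∈ G.Θ, G.gap b θ ≤ Γ := by
  obtain ⟨R, hR0, hR⟩ := G.isBounded_Θ.exists_pos_norm_le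
  refine ⟨(∑ a, ∑ b, ‖G.φ a - G.φ b‖) * R + 1, by positivity, fun b θ hθ => ?_⟩
  refine ciSup_le fun a => (real_inner_le_norm _ _).trans ?_
  have h1 : ‖G.φ a - G.φ b‖ ≤ ∑ a, ∑ b, ‖G.φ a - G.φ b‖ :=
    (Finset.single_le_sum (f := fun b => ‖G.φ a - G.φ b‖) (fun _ _ => norm_nonneg _)
      (Finset.mem_univ b)).trans (Finset.single_le_sum (f := fun a => ∑ b, ‖G.φ a - G.φ b‖)
      (fun _ _ => Finset.sum_nonneg fun _ _ => norm_nonneg _) (Finset.mem_univ a))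
  have := mul_le_mul h1 (hR θ hθ) (norm_nonneg _) ((norm_nonneg _).trans h1)
  linarith

/-- Global observability: the reward differences can be estimated with all actions. -/
theorem Game.IsGloballyObservable.exists_sq_inner_le {G : Game A d m}
    (hG : G.IsGloballyObservable) : ∃ x : ℝ, 0 ≤ x ∧ ∀ a ∈ G.pareto, ∀ b ∈ G.pareto, ∀ ν ∈ G.V,
      ⟪G.φ a - G.φ b, ν⟫_ℝ ^ 2 ≤ x * ∑ c, ‖G.M c ν‖ ^ 2 := by
  classical
  have hex : ∀ p : A × A, ∃ C : ℝ, 0 ≤ C ∧ (p.1 ∈ G.pareto → p.2 ∈ G.pareto →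
      ∀ ν ∈ G.V, ⟪G.φ p.1 - G.φ p.2, ν⟫_ℝ ^ 2 ≤ C * ∑ c, ‖G.M c ν‖ ^ 2) := by
    intro p
    by_cases hp : p.1 ∈ G.pareto ∧ p.2 ∈ G.pareto
    · obtain ⟨C, hC, h⟩ := G.exists_sq_inner_le Finset.univ (G.φ p.1 - G.φ p.2) fun ν hν h0 =>
        hG.inner_eq_zero G hp.1 hp.2 hν fun c => h0 c (Finset.mem_univ c)
      exact ⟨C, hC, fun _ _ => h⟩
    · exact ⟨0, le_rfl, fun h1 h2 => (hp ⟨h1, h2⟩).elim⟩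
  choose C hC0 hC using hex
  refine ⟨∑ p, C p, Finset.sum_nonneg fun p _ => hC0 p, fun a ha b hb ν hν => ?_⟩
  refine (hC (a, b) ha hb ν hν).trans ?_
  exact mul_le_mul_of_nonneg_right (Finset.single_le_sum (fun p _ => hC0 p)
    (Finset.mem_univ (a, b))) (Finset.sum_nonneg fun _ _ => sq_nonneg _)

/-- Local observability: the differences of the rewards of plausible actions can be estimated with
actions of small gap. -/
theorem Game.IsLocallyObservable.exists_design {G : Game A d m} (hG : G.IsLocallyObservable) :
    ∃ α : ℝ, 0 ≤ α ∧ ∀ E ⊆ G.Θ, E.Nonempty → ∀ ε : ℝ, 0 ≤ ε →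
      (∀ b ∈ G.plausible E, ∀ θ ∈ E, G.gap b θ ≤ ε) →
      ∃ S : Finset A, S.Nonempty ∧ ∃ x η : ℝ, 0 ≤ x ∧ 0 ≤ η ∧ η ^ 2 * x ≤ α ∧
        (∀ c ∈ S, ∀ θ ∈ E, G.gap c θ ≤ η * ε) ∧
        ∀ a ∈ G.plausible E, ∀ b ∈ G.plausible E, ∀ ν ∈ G.V,
          ⟪G.φ a - G.φ b, ν⟫_ℝ ^ 2 ≤ x * ∑ c ∈ S, ‖G.M c ν‖ ^ 2 := by
  classical
  -- A bound strictly above the supremum is exceeded by no `E`, and the infimum over `η` then has a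
  -- concrete `η` below it.
  obtain ⟨α, hα⟩ := ENNReal.lt_iff_exists_nnreal_btwn.1 hG
  refine ⟨α, α.2, fun E hE ⟨θ, hθ⟩ ε hε hgap => ?_⟩
  have hlt : G.align E < α := lt_of_le_of_lt (le_iSup₂ (f := fun (E : Set (Vec d))
    (_ : E ⊆ G.Θ) => G.align E) E hE) hα.1
  obtain ⟨η, hη⟩ := iInf_lt_iff.1 hlt
  obtain ⟨hη0, hη⟩ := iInf_lt_iff.1 hη
  have hfin : G.alignAt η E ≠ ∞ := by
    intro h
    rw [h, ENNReal.mul_top (by simpa using hη0.ne')] at hη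
    exact not_top_lt hη
  obtain ⟨o, ho, hoθ⟩ := G.exists_pareto_optimal (hE hθ)
  have hoE : o ∈ G.plausible E := ⟨ho, θ, hθ, G.gap_eq_zero_iff.2 hoθ⟩
  have hinf : ∀ ν ∈ G.V, ∀ a ∈ G.plausible E, ∀ b ∈ G.plausible E,
      ⨅ c ∈ G.extPlausible η E, ENNReal.ofReal (⟪G.φ a - G.φ b, ν⟫_ℝ ^ 2) /
        ENNReal.ofReal (‖G.M c ν‖ ^ 2) ≤ G.alignAt η E := fun ν hν a ha b hb =>
    le_iSup₂_of_le ν hν (le_iSup₂_of_le a ha (le_iSup₂_of_le b hb le_rfl))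
  -- Over an empty set of actions the infimum would be ∞, even for zero reward differences.
  have hne : (G.extPlausible η E).Nonempty := by
    by_contra hne
    have := hinf 0 (zero_mem _) o hoE o hoE
    rw [Set.not_nonempty_iff_eq_empty.1 hne] at this
    simp only [Set.mem_empty_iff_false, not_false_eq_true, iInf_neg, iInf_top, top_le_iff] at this
    exact hfin this
  refine ⟨(G.extPlausible η E).toFinset, by simpa using hne, (G.alignAt η E).toReal, η,
    ENNReal.toReal_nonneg, η.2, ?_, fun c hc θ' hθ' => ?_, fun a ha b hb ν hν => ?_⟩
  · have := ENNReal.toReal_mono ENNReal.coe_ne_top hη.le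
    simpa using this
  · rw [Set.mem_toFinset] at hc
    have h1 : ENNReal.ofReal (G.gap c θ') ≤ η * ENNReal.ofReal ε :=
      (le_iSup₂ (f := fun θ (_ : θ ∈ E) => ENNReal.ofReal (G.gap c θ)) θ' hθ').trans
        (hc.trans (mul_le_mul_right (iSup₂_le fun b hb => iSup₂_le fun θ hθ =>
          ENNReal.ofReal_le_ofReal (hgap b hb θ hθ)) _))
    rw [← ENNReal.ofReal_coe_nnreal, ← ENNReal.ofReal_mul (NNReal.coe_nonneg η)] at h1
    exact (ENNReal.ofReal_le_ofReal_iff (by positivity)).1 h1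
  · have hle := hinf ν hν a ha b hb
    obtain ⟨c, hc, hcmin⟩ := (G.extPlausible η E).toFinset.exists_min_image
      (fun c => ENNReal.ofReal (⟪G.φ a - G.φ b, ν⟫_ℝ ^ 2) / ENNReal.ofReal (‖G.M c ν‖ ^ 2))
      (by simpa using hne)
    have h1 : ENNReal.ofReal (⟪G.φ a - G.φ b, ν⟫_ℝ ^ 2) / ENNReal.ofReal (‖G.M c ν‖ ^ 2) ≤
        G.alignAt η E :=
      le_trans (le_iInf₂ fun c' hc' => hcmin c' (by simpa using hc')) hle
    rw [ENNReal.div_le_iff_le_mul (Or.inr hfin) (Or.inl ENNReal.ofReal_ne_top),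
      ← ENNReal.ofReal_toReal hfin, ← ENNReal.ofReal_mul ENNReal.toReal_nonneg,
      ENNReal.ofReal_le_ofReal_iff (by positivity)] at h1
    refine h1.trans (mul_le_mul_of_nonneg_left ?_ ENNReal.toReal_nonneg)
    exact Finset.single_le_sum (f := fun c => ‖G.M c ν‖ ^ 2) (fun _ _ => sq_nonneg _) hc

variable [MeasurableSpace A] [MeasurableSingletonClass A]

/-- Confidence level `L = 4 * log n` outweighs the cubic factor of the failure event. -/
theorem exp_remainder_le {n : ℕ} (hn : 1 ≤ n) {Γ N : ℝ} (hΓ : 0 ≤ Γ) (hN : 0 ≤ N) :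
    n * Γ * Real.exp (-(4 * Real.log n)) * (N * n ^ 2) ≤ Γ * N := by
  have hn0 : (0 : ℝ) < n := by exact_mod_cast hn
  have hexp : Real.exp (-(4 * Real.log n)) = ((n : ℝ) ^ 4)⁻¹ := by
    rw [Real.exp_neg, mul_comm, Real.exp_mul, Real.exp_log hn0]
    norm_cast
  rw [hexp]
  calc n * Γ * ((n : ℝ) ^ 4)⁻¹ * (N * n ^ 2) = Γ * N / n := by field_simp
    _ ≤ Γ * N := div_le_self (by positivity) (by exact_mod_cast hn)

theorem minimaxRegret_le_of_isGloballyObservable {ρ : ℝ} {𝒩 : Set (Noise A m)}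
    (h_sub : ∀ ξ ∈ 𝒩, ξ.IsSubGaussian ρ) (hG : G.IsGloballyObservable) :
    ∃ C : ℝ, 0 < C ∧ ∀ᶠ n : ℕ in atTop, minimaxRegret G 𝒩 n ≤
      ((C * (n : ℝ) ^ (2 / 3 : ℝ) * Real.log n ^ 1 : ℝ) : EReal) := by
  obtain ⟨x, hx, hxle⟩ := hG.exists_sq_inner_le
  obtain ⟨Γ, hΓ, hgap⟩ := exists_gap_le G
  set a : ℝ := ((Fintype.card A : ℕ) : ℝ) with ha
  have hlog : ∀ᶠ n : ℕ in atTop, 1 ≤ Real.log n :=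
    (Real.tendsto_log_atTop.comp tendsto_natCast_atTop_atTop).eventually_ge_atTop 1
  refine ⟨2 * (a * Γ * (128 * ρ ^ 2 * x + 2) + 1) + Γ * (2 * a ^ 2), by positivity, ?_⟩
  filter_upwards [hlog, eventually_ge_atTop 1] with n hl hn
  have hn1 : (1 : ℝ) ≤ n := by exact_mod_cast hn
  set l := Real.log n
  set y : ℝ := (n : ℝ) ^ (1 / 3 : ℝ) with hy
  have hy1 : 1 ≤ y := Real.one_le_rpow hn1 (by norm_num)
  have hyn : y ^ 3 = n := by
    rw [hy, ← Real.rpow_natCast, ← Real.rpow_mul (by positivity)]; norm_num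
  have hy2 : (n : ℝ) ^ (2 / 3 : ℝ) = y ^ 2 := by
    rw [hy, ← Real.rpow_natCast, ← Real.rpow_mul (by positivity)]; norm_num
  have hyl : 1 ≤ y ^ 2 * l := one_le_mul_of_one_le_of_one_le (one_le_pow₀ hy1) hl
  have hy2l : y ^ 2 ≤ y ^ 2 * l := le_mul_of_one_le_right (by positivity) hl
  set B : ℝ := (a * Γ * (128 * ρ ^ 2 * x + 2) + 1) * (y ^ 2 * l) with hB
  -- Explore once to accuracy n^(-1/3), then commit.
  have hmain := minimaxRegret_le G h_sub (K := 1) (n := n) (B := B)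
    (ε := fun k => if k = 0 then Γ else y⁻¹) (L := 4 * l) (by positivity)
    (fun k => by split_ifs <;> positivity) (by simpa using hgap) (by
      simp only [one_ne_zero, if_false]
      rw [← hyn, show y ^ 3 * y⁻¹ = y ^ 2 by field_simp]
      refine hy2l.trans (le_mul_of_one_le_left (by positivity) ?_)
      have : 0 ≤ a * Γ * (128 * ρ ^ 2 * x + 2) := by positivity
      linarith) (by
      intro k hk E hE _ _
      obtain rfl : k = 0 := by omega
      refine ⟨Finset.univ, Finset.univ_nonempty, x, Γ, hx, hΓ.le,
        fun c _ θ hθ => hgap c θ (hE hθ), fun a ha b hb => hxle a ha.1 b hb.1, fun s hs _ hs' => ?_⟩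
      simp only [zero_add, one_ne_zero, if_false] at hs'
      have h1 : 2 * ρ ^ 2 * (4 * l) * x / (y⁻¹ / 4) ^ 2 = 128 * ρ ^ 2 * x * (y ^ 2 * l) := by
        field_simp; ring
      rw [h1] at hs'
      calc s * Γ ≤ a * (128 * ρ ^ 2 * x * (y ^ 2 * l) + 2) * Γ := by gcongr
        _ ≤ a * (128 * ρ ^ 2 * x * (y ^ 2 * l) + 2 * (y ^ 2 * l)) * Γ := by gcongr; linarith
        _ = a * Γ * (128 * ρ ^ 2 * x + 2) * (y ^ 2 * l) := by ring
        _ ≤ B := by rw [hB]; gcongr; linarith)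
  refine hmain.trans (EReal.coe_le_coe_iff.2 ?_)
  rw [hy2, pow_one]
  have hrem := exp_remainder_le hn hΓ.le (show 0 ≤ 2 * a ^ 2 by positivity)
  simp only [if_true]
  have h2 : Γ * (2 * a ^ 2) ≤ Γ * (2 * a ^ 2) * (y ^ 2 * l) :=
    le_mul_of_one_le_right (by positivity) hyl
  calc _ ≤ (((1 : ℕ) : ℝ) + 1) * B + Γ * (2 * a ^ 2) := by gcongr
    _ ≤ (((1 : ℕ) : ℝ) + 1) * B + Γ * (2 * a ^ 2) * (y ^ 2 * l) := by gcongr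
    _ = _ := by rw [hB]; push_cast; ring

theorem minimaxRegret_le_of_isLocallyObservable {ρ : ℝ} {𝒩 : Set (Noise A m)}
    (h_sub : ∀ ξ ∈ 𝒩, ξ.IsSubGaussian ρ) (hG : G.IsLocallyObservable) :
    ∃ C : ℝ, 0 < C ∧ ∀ᶠ n : ℕ in atTop, minimaxRegret G 𝒩 n ≤
      ((C * (n : ℝ) ^ (1 / 2 : ℝ) * Real.log n ^ 2 : ℝ) : EReal) := by
  obtain ⟨α, hα, hdes⟩ := hG.exists_design
  obtain ⟨Γ, hΓ, hgap⟩ := exists_gap_le G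
  set a : ℝ := ((Fintype.card A : ℕ) : ℝ) with ha
  have ha1 : 1 ≤ a := by rw [ha]; exact_mod_cast Fintype.card_pos
  set q : ℝ := a * (512 * ρ ^ 2 * α + 2 * Γ ^ 2) with hq
  have hq0 : 0 < q := by positivity
  have hlog : ∀ᶠ n : ℕ in atTop, 1 ≤ Real.log n :=
    (Real.tendsto_log_atTop.comp tendsto_natCast_atTop_atTop).eventually_ge_atTop 1
  refine ⟨4 * √q + Γ * (2 * a ^ 2), by positivity, ?_⟩
  filter_upwards [hlog, eventually_ge_atTop 1] with n hl hn
  have hn1 : (1 : ℝ) ≤ n := by exact_mod_cast hn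
  set l := Real.log n with hl'
  set y : ℝ := √n with hy
  have hy1 : 1 ≤ y := Real.one_le_sqrt.2 hn1
  have hyn : y ^ 2 = n := Real.sq_sqrt (by positivity)
  -- Since 2 log 2 > 1, this many halvings bring the accuracy below Γ / n.
  set K : ℕ := ⌈2 * l⌉₊ with hK
  have hKle : (K : ℝ) ≤ 2 * l + 1 := (Nat.ceil_lt_add_one (by positivity)).le
  have hnK : (n : ℝ) ≤ 2 ^ K := by
    have h1 : (n : ℝ) = Real.exp l := (Real.exp_log (by positivity)).symm
    have h2 : (2 : ℝ) ^ K = Real.exp (K * Real.log 2) := by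
      rw [mul_comm, Real.exp_mul, Real.exp_log (by norm_num), Real.rpow_natCast]
    rw [h1, h2]
    refine Real.exp_le_exp.2 ?_
    have h3 : 2 * l ≤ K := Nat.le_ceil _
    nlinarith [Real.log_two_gt_d9]
  set B : ℝ := √q * (y * l) with hB
  have hB0 : 0 ≤ B := by positivity
  have hBsq : B ^ 2 = q * (n * l ^ 2) := by
    rw [hB, mul_pow, Real.sq_sqrt hq0.le, mul_pow, hyn]
  have hΓB : Γ ≤ B := by
    refine le_of_sq_le_sq ?_ hB0
    rw [hBsq]
    have h1 : 1 ≤ (n : ℝ) * l ^ 2 := one_le_mul_of_one_le_of_one_le hn1 (one_le_pow₀ hl)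
    have h2 : Γ ^ 2 ≤ q := by
      have : 0 ≤ 512 * ρ ^ 2 * α := by positivity
      nlinarith [sq_nonneg Γ]
    exact h2.trans (le_mul_of_one_le_right hq0.le h1)
  have hmain := minimaxRegret_le G h_sub (K := K) (n := n) (B := B)
    (ε := fun k => Γ / 2 ^ k) (L := 4 * l) (by positivity)
    (fun k => by positivity) (by simpa using hgap) (by
      refine le_trans ?_ hΓB
      rw [mul_div_assoc', div_le_iff₀ (by positivity), mul_comm]
      gcongr) (by
      intro k _ E hE hne hEgap
      obtain ⟨S, hS, x, η, hx, hη, hηx, hSgap, hinfo⟩ := hdes E hE hne _ (by positivity) hEgap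
      -- The cap at Γ controls the additive 2 in the phase length, as `η` itself has no bound.
      refine ⟨S, hS, x, min (η * (Γ / 2 ^ k)) Γ, hx, by positivity,
        fun c hc θ hθ => le_min (hSgap c hc θ hθ) (hgap c θ (hE hθ)), hinfo, fun s hs hsn hs' => ?_⟩
      set ε := Γ / 2 ^ k with hε
      have hε0 : 0 < ε := by positivity
      set γ := min (η * ε) Γ with hγ
      have hγ0 : 0 ≤ γ := by positivity
      have h1 : Γ / 2 ^ (k + 1) / 4 = ε / 8 := by rw [hε, pow_succ]; field_simp; norm_num
      rw [h1] at hs'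
      have h2 : x * γ ^ 2 ≤ α * ε ^ 2 := by
        calc x * γ ^ 2 ≤ x * (η * ε) ^ 2 := by gcongr; exact min_le_left _ _
          _ = η ^ 2 * x * ε ^ 2 := by ring
          _ ≤ α * ε ^ 2 := by gcongr
      have h3 : γ ^ 2 ≤ Γ ^ 2 := by gcongr; exact min_le_right _ _
      refine le_of_sq_le_sq ?_ hB0
      rw [hBsq]
      have h4 : 2 * ρ ^ 2 * (4 * l) * x / (ε / 8) ^ 2 * γ ^ 2 ≤ 512 * ρ ^ 2 * α * l := by
        calc 2 * ρ ^ 2 * (4 * l) * x / (ε / 8) ^ 2 * γ ^ 2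
            = 512 * ρ ^ 2 * l / ε ^ 2 * (x * γ ^ 2) := by field_simp; ring
          _ ≤ 512 * ρ ^ 2 * l / ε ^ 2 * (α * ε ^ 2) := by gcongr
          _ = 512 * ρ ^ 2 * α * l := by field_simp
      have hl2 : l ≤ l ^ 2 := by nlinarith
      have hl3 : 1 ≤ l ^ 2 := one_le_pow₀ hl
      -- One factor `s` is bounded by the horizon, the other by the phase length, where `η ^ 2 * x ≤
      -- α` cancels the dependence on `ε`.
      calc (s * γ) ^ 2 = s * (s * γ ^ 2) := by ring
        _ ≤ n * (a * (2 * ρ ^ 2 * (4 * l) * x / (ε / 8) ^ 2 + 2) * γ ^ 2) := by gcongr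
        _ = n * (a * (2 * ρ ^ 2 * (4 * l) * x / (ε / 8) ^ 2 * γ ^ 2 + 2 * γ ^ 2)) := by ring
        _ ≤ n * (a * (512 * ρ ^ 2 * α * l + 2 * Γ ^ 2)) := by gcongr
        _ ≤ n * (a * (512 * ρ ^ 2 * α * l ^ 2 + 2 * Γ ^ 2 * l ^ 2)) := by
          have h5 : 2 * Γ ^ 2 ≤ 2 * Γ ^ 2 * l ^ 2 := le_mul_of_one_le_right (by positivity) hl3
          gcongr
        _ = q * (n * l ^ 2) := by rw [hq]; ring)
  refine hmain.trans (EReal.coe_le_coe_iff.2 ?_)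
  rw [← Real.sqrt_eq_rpow, ← hy]
  have hrem := exp_remainder_le hn hΓ.le (show 0 ≤ 2 * a ^ 2 by positivity)
  simp only [pow_zero, div_one]
  have h2 : Γ * (2 * a ^ 2) ≤ Γ * (2 * a ^ 2) * (y * l ^ 2) :=
    le_mul_of_one_le_right (by positivity) (one_le_mul_of_one_le_of_one_le hy1 (one_le_pow₀ hl))
  calc _ ≤ (K + 1) * B + Γ * (2 * a ^ 2) := by gcongr
    _ ≤ (4 * l) * B + Γ * (2 * a ^ 2) * (y * l ^ 2) := by
      gcongr
      linarith
    _ = _ := by rw [hB]; ring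

theorem minimaxRegret_eq_zero_of_isTrivial {𝒩 : Set (Noise A m)} (hne : 𝒩.Nonempty)
    (hG : G.IsTrivial) (n : ℕ) : minimaxRegret G 𝒩 n = 0 := by
  obtain ⟨a, ha⟩ := hG
  refine le_antisymm ?_ (le_iInf fun π => ?_)
  · let π : Policy A m := ⟨fun _ => Kernel.deterministic (fun _ => a) measurable_const,
      fun _ => inferInstance⟩
    refine (iInf_le _ π).trans (iSup₂_le fun θ hθ => iSup₂_le fun ξ _ => ?_)
    have hgap : G.gap a θ = 0 := G.gap_eq_zero_iff.2 (show θ ∈ G.cell a from ha ▸ hθ).2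
    have hzero : ∀ t, ∫⁻ h, ENNReal.ofReal (cumGap G θ h) ∂(histLaw G π θ ξ t) = 0 := by
      intro t
      induction t with
      | zero => simp [cumGap]
      | succ t ih =>
        rw [lintegral_histLaw_succ G π θ ξ (measurable_cumGap G θ (t + 1)).ennreal_ofReal, ← ih]
        refine lintegral_congr fun h => ?_
        refine (Kernel.lintegral_deterministic (g := fun _ => a) measurable_const).trans ?_
        simp [cumGap_ext, hgap]
    have := ofReal_regret G π θ ξ n
    rw [hzero, ENNReal.ofReal_eq_zero] at this
    exact_mod_cast this
  · obtain ⟨θ, hθ⟩ := G.nonempty_Θ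
    obtain ⟨ξ, hξ⟩ := hne
    refine le_iSup₂_of_le θ hθ (le_iSup₂_of_le ξ hξ ?_)
    exact_mod_cast regret_nonneg G π θ ξ n

end Rates

end LinearPM

end

theorem mainTheorem3 {A : Type*} [Finite A] [Nonempty A] [MeasurableSpace A]
    [MeasurableSingletonClass A] {d m : ℕ} (G : LinearPM.Game A d m) (ρ : ℝ) (hρ : 0 < ρ)
    (𝒩 : Set (LinearPM.Noise A m)) (h_gauss : LinearPM.gaussianNoise A m ρ ∈ 𝒩)
    (h_sub : ∀ ξ ∈ 𝒩, ξ.IsSubGaussian ρ) :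
    (G.IsTrivial → ∀ n : ℕ, LinearPM.minimaxRegret G 𝒩 n = 0) ∧
    (G.IsEasy →
      LinearPM.IsThetaTilde (LinearPM.minimaxRegret G 𝒩) (fun n => (n : ℝ) ^ (1 / 2 : ℝ))) ∧
    (G.IsHard →
      LinearPM.IsThetaTilde (LinearPM.minimaxRegret G 𝒩) (fun n => (n : ℝ) ^ (2 / 3 : ℝ))) ∧
    (G.IsHopeless →
      LinearPM.IsOmega (LinearPM.minimaxRegret G 𝒩) (fun n => (n : ℝ))) := by
  cases nonempty_fintype A
  refine ⟨fun hG => LinearPM.minimaxRegret_eq_zero_of_isTrivial G ⟨_, h_gauss⟩ hG, fun hG => ?_,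
    fun hG => ?_, fun hG => LinearPM.isOmega_of_isHopeless G hρ h_gauss h_sub hG⟩
  · obtain ⟨C, hC, h⟩ := LinearPM.minimaxRegret_le_of_isLocallyObservable G h_sub hG.1
    exact LinearPM.isThetaTilde_of_isOmega (fun n => by positivity)
      (LinearPM.isOmega_sqrt_of_not_isTrivial G hρ h_gauss h_sub hG.2) hC h
  · obtain ⟨C, hC, h⟩ := LinearPM.minimaxRegret_le_of_isGloballyObservable G h_sub hG.1
    exact LinearPM.isThetaTilde_of_isOmega (fun n => by positivity)
      (LinearPM.isOmega_of_not_isLocallyObservable G hρ h_gauss h_sub hG.2) hC h
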